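/- Let $M$ be a compact complex manifold of complex dimension $n\ge 2$ with a Hermitian metric $g=(g_{i\bar j})$ and fundamental form $\omega_g=\sqrt{-1}\,g_{i\bar j}\,dz^i\wedge d\bar z^j$, and let $p>1$ be a real number. Let $\Theta_{i\bar jk\bar\ell}$ be the curvature of the Chern connection of $g$ and $s_g=g^{i\bar j}g^{k\bar\ell}\Theta_{i\bar jk\bar\ell}$ the Chern scalar curvature. Define the $p$-Calabi functional $$C_p(\omega_g)=\Big(\int_M|s_g|^p\,\frac{\omega_g^n}{n!}\Big)\Big(\int_M\frac{\omega_g^n}{n!}\Big)^{-\frac{n-p}{n}},$$ and call $\omega_g$ $p$-conformal extremal if $\frac{d}{dt}\big|_{t=0}C_p(e^{tf}\omega_g)=0$ (the derivative existing) for every $f\in C^\infty(M,\mathbb R)$. Let $\square_g f=\mathrm{tr}_{\omega_g}\sqrt{-1}\,\partial\bar\partial f=g^{i\bar j}\,\partial^2 f/\partial z^i\partial\bar z^j$ on smooth functions, and let $\square_g^*$ be its formal adjoint with respect to the volume form $\omega_g^n/n!$. Then $\omega_g$ is $p$-conformal extremal if and only if $$\square_g^*\big(s_g|s_g|^{p-2}\big)=\frac{n-p}{np}\Big(|s_g|^p-\frac{1}{V}\int_M|s_g|^p\,\frac{\omega_g^n}{n!}\Big)$$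 holds in the sense of distributions, that is, for every $\varphi\in C^\infty(M,\mathbb R)$, $$\int_M s_g|s_g|^{p-2}\,\square_g\varphi\,\frac{\omega_g^n}{n!}=\frac{n-p}{np}\int_M\Big(|s_g|^p-\frac{1}{V}\int_M|s_g|^p\,\frac{\omega_g^n}{n!}\Big)\varphi\,\frac{\omega_g^n}{n!}.$$ Here $V=\int_M\frac{\omega_g^n}{n!}$ is the total volume, and $s_g|s_g|^{p-2}$ is read as $0$ where $s_g=0$. -/

import Mathlib

open Set MeasureTheory
open scoped Manifold ContDiff ComplexConjugate

noncomputable section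

/-- The model space `ℂⁿ` of an `n`-dimensional complex manifold. A complex manifold is a charted
space over `ℂⁿ` whose coordinate changes are complex analytic; its underlying smooth manifold is
the same charted space, with `ℂⁿ` regarded as a real vector space. -/
abbrev CSpace (n : ℕ) : Type := Fin n → ℂ

/-! ### Wirtinger calculus on `ℂⁿ` -/

/-- The Wirtinger derivative `∂F/∂zⁱ = (∂F/∂xⁱ - √-1 ∂F/∂yⁱ) / 2`. -/
def dz {n : ℕ} (i : Fin n) (F : CSpace n → ℂ) (z : CSpace n) : ℂ :=
  (1 / 2 : ℂ) * (fderiv ℝ F z (Pi.single i 1) - Complex.I * fderiv ℝ F z (Pi.single i Complex.I))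

/-- The Wirtinger derivative `∂F/∂z̄ⁱ = (∂F/∂xⁱ + √-1 ∂F/∂yⁱ) / 2`. -/
def dzbar {n : ℕ} (i : Fin n) (F : CSpace n → ℂ) (z : CSpace n) : ℂ :=
  (1 / 2 : ℂ) * (fderiv ℝ F z (Pi.single i 1) + Complex.I * fderiv ℝ F z (Pi.single i Complex.I))

/-! ### The smooth manifold underlying a complex manifold -/

/-- A complex manifold modelled on `ℂⁿ` is a smooth real manifold. -/
theorem isManifold_real (n : ℕ) (M : Type*) [TopologicalSpace M] [ChartedSpace (CSpace n) M]
    [IsManifold 𝓘(ℂ, CSpace n) ω M] : IsManifold 𝓘(ℝ, CSpace n) ∞ M := by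
  apply isManifold_of_contDiffOn
  intro e e' he he'
  have h := (contDiffGroupoid ω 𝓘(ℂ, CSpace n)).compatible he he'
  have h1 := (contMDiffOn_iff_contDiffOn).1 (contMDiffOn_of_mem_contDiffGroupoid h)
  have h2 := (h1.restrict_scalars ℝ).of_le (n := ω) (m := ∞) le_top
  simpa using h2

/-- A smooth function on a complex manifold is smooth in every holomorphic chart of the atlas. -/
theorem contDiffOn_comp_chart_symm {n : ℕ} {M : Type*} [TopologicalSpace M]
    [ChartedSpace (CSpace n) M] [IsManifold 𝓘(ℂ, CSpace n) ω M]
    (f : C^∞⟮𝓘(ℝ, CSpace n), M; 𝓘(ℝ, ℝ), ℝ⟯) (e : OpenPartialHomeomorph M (CSpace n))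
    (he : e ∈ atlas (CSpace n) M) : ContDiffOn ℝ ∞ (fun z => f (e.symm z)) e.target := by
  have := isManifold_real n M
  have h : ContMDiffOn 𝓘(ℝ, CSpace n) 𝓘(ℝ, CSpace n) ∞ e.symm e.target :=
    contMDiffOn_symm_of_mem_maximalAtlas (IsManifold.subset_maximalAtlas he)
  exact contMDiffOn_iff_contDiffOn.1 (f.contMDiff.comp_contMDiffOn h)

/-! ### Hermitian metrics -/

/-- A (smooth) Hermitian metric on a complex manifold `M` of dimension `n`: a positive definite
Hermitian form on every holomorphic tangent space, complex linear in the first and conjugate linear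
in the second argument, whose components `g_{ij̄} = g(∂/∂zⁱ, ∂/∂zʲ)` in every holomorphic chart are
smooth functions of the coordinates. Its fundamental form is `√-1 ∑ g_{ij̄} dzⁱ ∧ dz̄ʲ`. -/
structure HermitianMetric (n : ℕ) (M : Type*) [TopologicalSpace M]
    [ChartedSpace (CSpace n) M] where
  /-- the Hermitian form on the tangent space at `x` -/
  form : ∀ x : M, TangentSpace 𝓘(ℂ, CSpace n) x →ₗ[ℂ] TangentSpace 𝓘(ℂ, CSpace n) x →ₗ⋆[ℂ] ℂ
  form_conj : ∀ (x : M) (u v : TangentSpace 𝓘(ℂ, CSpace n) x),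
    form x v u = conj (form x u v)
  form_pos : ∀ (x : M) (v : TangentSpace 𝓘(ℂ, CSpace n) x), v ≠ 0 → 0 < (form x v v).re
  smooth : ∀ e ∈ atlas (CSpace n) M, ∀ i j : Fin n,
    ContDiffOn ℝ ∞ (fun z : CSpace n => form (e.symm z)
      (mfderiv 𝓘(ℂ, CSpace n) 𝓘(ℂ, CSpace n) e.symm z
        (Pi.single i 1 : CSpace n))
      (mfderiv 𝓘(ℂ, CSpace n) 𝓘(ℂ, CSpace n) e.symm z
        (Pi.single j 1 : CSpace n))) e.target

namespace HermitianMetric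

section Local

variable {n : ℕ} {M : Type*} [TopologicalSpace M] [ChartedSpace (CSpace n) M]
  (g : HermitianMetric n M) (e : OpenPartialHomeomorph M (CSpace n))

/-- The matrix `(g_{ij̄})` of the metric in the chart `e`, at the point with coordinates `z`. -/
def coeff (z : CSpace n) : Matrix (Fin n) (Fin n) ℂ :=
  Matrix.of fun i j => g.form (e.symm z)
    (mfderiv 𝓘(ℂ, CSpace n) 𝓘(ℂ, CSpace n) e.symm z (Pi.single i 1 : CSpace n))
    (mfderiv 𝓘(ℂ, CSpace n) 𝓘(ℂ, CSpace n) e.symm z (Pi.single j 1 : CSpace n))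

/-- The components `g^{ij̄}` of the inverse metric, normalized by `∑_j g^{ij̄} g_{kj̄} = δ^i_k`. -/
def invCoeff (z : CSpace n) : Matrix (Fin n) (Fin n) ℂ :=
  ((g.coeff e z)⁻¹).transpose

/-- The Christoffel symbols `Γ^p_{ik} = ∑_q g^{pq̄} ∂g_{kq̄}/∂zⁱ` of the Chern connection. -/
def christoffel (p i k : Fin n) (z : CSpace n) : ℂ :=
  ∑ q, g.invCoeff e z p q * dz i (fun w => g.coeff e w k q) z

/-- The components `Θ_{ij̄kl̄} = ∑_p g_{pl̄} Θ_{ij̄k}^p`, `Θ_{ij̄k}^p = -∂Γ^p_{ik}/∂z̄ʲ`, of the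
curvature of the Chern connection, that is
`Θ_{ij̄kl̄} = -∂²g_{kl̄}/∂zⁱ∂z̄ʲ + ∑ g^{pq̄} (∂g_{kq̄}/∂zⁱ) (∂g_{pl̄}/∂z̄ʲ)`. -/
def chernCurvature (i j k l : Fin n) (z : CSpace n) : ℂ :=
  ∑ p, g.coeff e z p l * -(dzbar j (g.christoffel e p i k) z)

/-- The Chern scalar curvature `∑ g^{ij̄} g^{kl̄} Θ_{ij̄kl̄}` in the chart `e`. -/
def chernScalarChart (z : CSpace n) : ℂ :=
  ∑ i, ∑ j, ∑ k, ∑ l, g.invCoeff e z i j * g.invCoeff e z k l * g.chernCurvature e i j k l z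

/-- The trace `tr_ω √-1∂∂̄f = ∑ g^{ij̄} ∂²f/∂zⁱ∂z̄ʲ` in the chart `e`. -/
def boxChart (f : M → ℝ) (z : CSpace n) : ℂ :=
  ∑ i, ∑ j, g.invCoeff e z i j * dz i (dzbar j (fun w => (f (e.symm w) : ℂ))) z

end Local

section Global

variable {n : ℕ} {M : Type*} [TopologicalSpace M] [ChartedSpace (CSpace n) M]

/-- The Chern scalar curvature `s_g : M → ℝ`. The expression in coordinates is real and does not
depend on the chart; it is evaluated in the preferred chart at `x`. -/
def chernScalar (g : HermitianMetric n M) (x : M) : ℝ :=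
  (g.chernScalarChart (chartAt (CSpace n) x) (chartAt (CSpace n) x x)).re

/-- The complex Laplacian `□_g f = tr_ω √-1∂∂̄f` of a real function on `M`. The expression in
coordinates is real and does not depend on the chart. -/
def box (g : HermitianMetric n M) (f : M → ℝ) (x : M) : ℝ :=
  (g.boxChart (chartAt (CSpace n) x) f (chartAt (CSpace n) x x)).re

/-- The conformal metric `e^f g`, for a smooth real function `f`. -/
def conformal [IsManifold 𝓘(ℂ, CSpace n) ω M] (g : HermitianMetric n M)
    (f : C^∞⟮𝓘(ℝ, CSpace n), M; 𝓘(ℝ, ℝ), ℝ⟯) : HermitianMetric n M where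
  form x := (Real.exp (f x) : ℂ) • g.form x
  form_conj x u v := by
    simp only [LinearMap.smul_apply, smul_eq_mul, map_mul, Complex.conj_ofReal]
    rw [g.form_conj x u v]
  form_pos x v hv := by
    simp only [LinearMap.smul_apply, smul_eq_mul, Complex.re_ofReal_mul]
    exact mul_pos (Real.exp_pos _) (g.form_pos x v hv)
  smooth e he i j := by
    have h1 : ContDiffOn ℝ ∞ (fun z => (Real.exp (f (e.symm z)) : ℂ)) e.target :=
      Complex.ofRealCLM.contDiff.comp_contDiffOn (contDiffOn_comp_chart_symm f e he).exp
    exact h1.mul (g.smooth e he i j)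

/-- There is a partition of unity subordinate to the cover of `M` by chart domains. -/
theorem exists_chartPartition (n : ℕ) (M : Type*) [TopologicalSpace M]
    [ChartedSpace (CSpace n) M] [CompactSpace M] [T2Space M] :
    ∃ ρ : PartitionOfUnity M M univ, ρ.IsSubordinate fun x => (chartAt (CSpace n) x).source :=
  PartitionOfUnity.exists_isSubordinate isClosed_univ _
    (fun x => (chartAt (CSpace n) x).open_source)
    (fun x _ => mem_iUnion.2 ⟨x, mem_chart_source (CSpace n) x⟩)

/-- A partition of unity subordinate to the cover of `M` by chart domains. -/
def chartPartition (n : ℕ) (M : Type*) [TopologicalSpace M]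
    [ChartedSpace (CSpace n) M] [CompactSpace M] [T2Space M] : PartitionOfUnity M M univ :=
  (exists_chartPartition n M).choose

/-- The measure on `M` given by the volume form `ωⁿ/n!`, where `ω = √-1 ∑ g_{ij̄} dzⁱ ∧ dz̄ʲ`.
In a chart `ωⁿ/n! = det(g_{ij̄}) ∏ (√-1 dzⁱ ∧ dz̄ⁱ)`, which is `2ⁿ det(g_{ij̄})` times Lebesgue
measure, as `√-1 dz ∧ dz̄ = 2 dx ∧ dy`. The local expressions are glued, as usual, by a partition
of unity; the result does not depend on its choice. -/
def vol [CompactSpace M] [T2Space M] [MeasurableSpace M] (g : HermitianMetric n M) : Measure M :=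
  Measure.sum fun x : M =>
    ((volume.restrict (chartAt (CSpace n) x).target).withDensity fun z =>
      ENNReal.ofReal (chartPartition n M x ((chartAt (CSpace n) x).symm z) *
        (2 ^ n * (g.coeff (chartAt (CSpace n) x) z).det.re))).map (chartAt (CSpace n) x).symm

variable [CompactSpace M] [T2Space M] [MeasurableSpace M]

/-- The normalized `p`-Calabi functional
`C_p(ω) = (∫ |s|^p ωⁿ/n!) (∫ ωⁿ/n!)^(-(n-p)/n)`. -/
def calabi (p : ℝ) (g : HermitianMetric n M) : ℝ :=
  (∫ x, |g.chernScalar x| ^ p ∂g.vol) * (∫ _, (1 : ℝ) ∂g.vol) ^ (-((n - p) / n) : ℝ)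

/-- `g` is `p`-conformal extremal: for every smooth real `f`, the function `t ↦ C_p(e^{tf} ω)` is
differentiable at `t = 0`, with derivative zero. -/
def IsConformalExtremal [IsManifold 𝓘(ℂ, CSpace n) ω M] (p : ℝ) (g : HermitianMetric n M) : Prop :=
  ∀ f : C^∞⟮𝓘(ℝ, CSpace n), M; 𝓘(ℝ, ℝ), ℝ⟯,
    HasDerivAt (fun t : ℝ => (g.conformal (t • f)).calabi p) 0 0

/-- The distribution on `M` defined by a function `u`: the pairing `φ ↦ ∫ u φ ωⁿ/n!` with smooth
test functions. -/
def toDistribution (g : HermitianMetric n M) (u : M → ℝ)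
    (φ : C^∞⟮𝓘(ℝ, CSpace n), M; 𝓘(ℝ, ℝ), ℝ⟯) : ℝ :=
  ∫ x, u x * φ x ∂g.vol

/-- The formal adjoint `□_g^*` applied to a function `u` in the sense of distributions: the pairing
`φ ↦ ∫ u (□_g φ) ωⁿ/n!` with smooth test functions. -/
def boxAdjoint (g : HermitianMetric n M) (u : M → ℝ)
    (φ : C^∞⟮𝓘(ℝ, CSpace n), M; 𝓘(ℝ, ℝ), ℝ⟯) : ℝ :=
  ∫ x, u x * g.box φ x ∂g.vol

end Global

end HermitianMetric

end

/-!
Under a conformal change the Chern scalar curvature and the volume form transform by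
`s(e^f g) = e^{-f} (s_g - n □_g f)` and `dvol(e^f g) = e^{nf} dvol(g)`
(`HermitianMetric.chernScalar_conformal`, `HermitianMetric.vol_conformal`), so that
`C_p(e^{tf} ω) = (∫ e^{(n-p)tf} |s - n t □f|^p) (∫ e^{ntf})^{-(n-p)/n}`. As `|·|^p` is `C¹` for
`p > 1`, one may differentiate under the integral sign, and the derivative at `t = 0` is
`V^{-(n-p)/n} ((n-p) (∫ |s|^p f - V⁻¹ ∫ |s|^p ∫ f) - n p ∫ s |s|^{p-2} □f)`
(`HermitianMetric.hasDerivAt_calabi_conformal`). It vanishes exactly when the weak equation holds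
for the test function `f`; no integration by parts occurs, since the equation is distributional.

The integrals converge because `s_g` and `□_g f` are continuous and the volume is finite
(`HermitianMetric.isFiniteMeasure_vol`). Continuity requires that the expressions in coordinates do
not depend on the chart. For this, `s_g` is written as `tr (G⁻¹ R)`, where `G` is the matrix of the
metric and `R` is the Chern–Ricci curvature `-∂²(log det G)/∂zⁱ∂z̄ʲ`. A holomorphic coordinate change
with Jacobian `J` replaces `G` by `Jᵀ G J̄`, and `log det G` changes by the pluriharmonic function
`log |det J|²`, so `R` is a `(1,1)`-form (`chernRicci_comp`), as is the complex Hessian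
(`complexHessian_comp`). Only the logarithmic derivatives `tr (G⁻¹ ∂G/∂zⁱ)` enter, never a
logarithm. The conformal formula for `s_g` comes from `log det (e^F G) = n F + log det G`.
-/

noncomputable section

/-! ### Wirtinger calculus -/

section Wirtinger

variable {n : ℕ} {F G : CSpace n → ℂ} {z : CSpace n} {U : Set (CSpace n)}

open Filter Topology

theorem dz_congr (i : Fin n) (h : F =ᶠ[𝓝 z] G) : dz i F z = dz i G z := by
  simp only [dz, h.fderiv_eq]

theorem dzbar_congr (i : Fin n) (h : F =ᶠ[𝓝 z] G) : dzbar i F z = dzbar i G z := by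
  simp only [dzbar, h.fderiv_eq]

theorem dzbar_add (i : Fin n) (hF : DifferentiableAt ℝ F z) (hG : DifferentiableAt ℝ G z) :
    dzbar i (fun w => F w + G w) z = dzbar i F z + dzbar i G z := by
  simp only [dzbar, fderiv_fun_add hF hG, add_apply]
  ring

theorem dz_mul (i : Fin n) (hF : DifferentiableAt ℝ F z) (hG : DifferentiableAt ℝ G z) :
    dz i (fun w => F w * G w) z = dz i F z * G z + F z * dz i G z := by
  simp only [dz, fderiv_fun_mul hF hG, add_apply,
    smul_apply, smul_eq_mul]
  ring

theorem dzbar_mul (i : Fin n) (hF : DifferentiableAt ℝ F z) (hG : DifferentiableAt ℝ G z) :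
    dzbar i (fun w => F w * G w) z = dzbar i F z * G z + F z * dzbar i G z := by
  simp only [dzbar, fderiv_fun_mul hF hG, add_apply,
    smul_apply, smul_eq_mul]
  ring

theorem dz_const_mul (i : Fin n) (c : ℂ) (hF : DifferentiableAt ℝ F z) :
    dz i (fun w => c * F w) z = c * dz i F z := by
  simp only [dz, fderiv_const_mul hF, smul_apply, smul_eq_mul]
  ring

theorem dzbar_const_mul (i : Fin n) (c : ℂ) (hF : DifferentiableAt ℝ F z) :
    dzbar i (fun w => c * F w) z = c * dzbar i F z := by
  simp only [dzbar, fderiv_const_mul hF, smul_apply, smul_eq_mul]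
  ring

theorem dz_sum {ι : Type*} (s : Finset ι) (i : Fin n) {A : ι → CSpace n → ℂ}
    (h : ∀ a ∈ s, DifferentiableAt ℝ (A a) z) :
    dz i (fun w => ∑ a ∈ s, A a w) z = ∑ a ∈ s, dz i (A a) z := by
  simp only [dz, fderiv_fun_sum h, sum_apply, Finset.mul_sum,
    ← Finset.sum_sub_distrib]

theorem dzbar_sum {ι : Type*} (s : Finset ι) (i : Fin n) {A : ι → CSpace n → ℂ}
    (h : ∀ a ∈ s, DifferentiableAt ℝ (A a) z) :
    dzbar i (fun w => ∑ a ∈ s, A a w) z = ∑ a ∈ s, dzbar i (A a) z := by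
  simp only [dzbar, fderiv_fun_sum h, sum_apply, Finset.mul_sum,
    ← Finset.sum_add_distrib]

/-- The differential of `F` is `∑ (∂F/∂zᵃ dzᵃ + ∂F/∂z̄ᵃ dz̄ᵃ)`. -/
theorem fderiv_apply_eq_sum_dz (F : CSpace n → ℂ) (z v : CSpace n) :
    fderiv ℝ F z v = ∑ a, (v a * dz a F z + conj (v a) * dzbar a F z) := by
  have hv : v = ∑ a, ((v a).re • (Pi.single a 1 : CSpace n) +
      (v a).im • (Pi.single a Complex.I : CSpace n)) := by
    conv_lhs => rw [← Finset.univ_sum_single v]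
    refine Finset.sum_congr rfl fun a _ => ?_
    rw [← Pi.single_smul, ← Pi.single_smul, ← Pi.single_add]
    congr 1
    conv_lhs => rw [← Complex.re_add_im (v a)]
    simp
  conv_lhs => rw [hv]
  rw [map_sum]
  refine Finset.sum_congr rfl fun a _ => ?_
  have h1 := Complex.re_add_im (v a)
  have h2 : conj (v a) = (v a).re - (v a).im * Complex.I := by
    apply Complex.ext <;> simp
  rw [map_add, map_smul, map_smul, dz, dzbar, Complex.real_smul, Complex.real_smul, h2]
  linear_combination (1 / 2 * (fderiv ℝ F z (Pi.single a 1) -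
    Complex.I * fderiv ℝ F z (Pi.single a Complex.I))) * h1 +
    ((v a).im * fderiv ℝ F z (Pi.single a Complex.I)) * Complex.I_sq

theorem fderiv_single_I {h : CSpace n → ℂ} (i : Fin n) (hh : DifferentiableAt ℂ h z) :
    fderiv ℝ h z (Pi.single i Complex.I) = Complex.I * fderiv ℝ h z (Pi.single i 1) := by
  have : (Pi.single i Complex.I : CSpace n) = Complex.I • Pi.single i (1 : ℂ) := by
    rw [← Pi.single_smul]; simp
  rw [hh.fderiv_restrictScalars ℝ, this]
  simp only [ContinuousLinearMap.coe_restrictScalars']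
  rw [map_smul, smul_eq_mul]

theorem dzbar_of_holomorphic {h : CSpace n → ℂ} (i : Fin n) (hh : DifferentiableAt ℂ h z) :
    dzbar i h z = 0 := by
  rw [dzbar, fderiv_single_I i hh]
  linear_combination (1 / 2 * fderiv ℝ h z (Pi.single i 1)) * Complex.I_sq

theorem dz_of_holomorphic {h : CSpace n → ℂ} (i : Fin n) (hh : DifferentiableAt ℂ h z) :
    dz i h z = fderiv ℂ h z (Pi.single i 1) := by
  rw [dz, fderiv_single_I i hh, hh.fderiv_restrictScalars ℝ]
  simp only [ContinuousLinearMap.coe_restrictScalars']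
  linear_combination (-1 / 2 * fderiv ℂ h z (Pi.single i 1)) * Complex.I_sq

theorem fderiv_conj_apply {h : CSpace n → ℂ} (hh : DifferentiableAt ℝ h z) (v : CSpace n) :
    fderiv ℝ (fun w => conj (h w)) z v = conj (fderiv ℝ h z v) := by
  have := (Complex.conjCLE.toContinuousLinearMap.hasFDerivAt.comp z hh.hasFDerivAt).fderiv
  exact congrArg (fun T => T v) this

theorem differentiableAt_conj {h : CSpace n → ℂ} (hh : DifferentiableAt ℝ h z) :
    DifferentiableAt ℝ (fun w => conj (h w)) z :=
  Complex.conjCLE.toContinuousLinearMap.differentiableAt.comp z hh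

theorem dz_conj {h : CSpace n → ℂ} (i : Fin n) (hh : DifferentiableAt ℝ h z) :
    dz i (fun w => conj (h w)) z = conj (dzbar i h z) := by
  simp [dz, dzbar, fderiv_conj_apply hh, sub_eq_add_neg, Complex.conj_ofNat]

/-- The chain rule for a holomorphic change of coordinates `φ`. -/
theorem dz_comp {φ : CSpace n → CSpace n} (i : Fin n) (hφ : DifferentiableAt ℂ φ z)
    (hF : DifferentiableAt ℝ F (φ z)) :
    dz i (fun w => F (φ w)) z = ∑ a, dz i (fun w => φ w a) z * dz a F (φ z) := by
  have hφa : ∀ a, DifferentiableAt ℂ (fun w => φ w a) z := fun a => differentiableAt_pi.1 hφ a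
  have hφR : DifferentiableAt ℝ φ z := hφ.restrictScalars ℝ
  have h1 : ∀ v, fderiv ℝ (fun w => F (φ w)) z v =
      ∑ a, (fderiv ℝ (fun w => φ w a) z v * dz a F (φ z) +
        conj (fderiv ℝ (fun w => φ w a) z v) * dzbar a F (φ z)) := by
    intro v
    rw [show (fun w => F (φ w)) = F ∘ φ from rfl, fderiv_comp z hF hφR,
      ContinuousLinearMap.comp_apply, fderiv_apply_eq_sum_dz]
    simp only [fderiv_apply hφR, ContinuousLinearMap.comp_apply, ContinuousLinearMap.proj_apply]
  rw [dz, h1, h1, Finset.mul_sum, ← Finset.sum_sub_distrib, Finset.mul_sum]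
  refine Finset.sum_congr rfl fun a _ => ?_
  rw [dz_of_holomorphic i (hφa a), fderiv_single_I i (hφa a), (hφa a).fderiv_restrictScalars ℝ]
  simp only [ContinuousLinearMap.coe_restrictScalars', map_mul, Complex.conj_I]
  linear_combination (-1 / 2 * (fderiv ℂ (fun w => φ w a) z (Pi.single i 1) * dz a F (φ z) -
    conj (fderiv ℂ (fun w => φ w a) z (Pi.single i 1)) * dzbar a F (φ z))) * Complex.I_sq

theorem dzbar_comp {φ : CSpace n → CSpace n} (i : Fin n) (hφ : DifferentiableAt ℂ φ z)
    (hF : DifferentiableAt ℝ F (φ z)) :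
    dzbar i (fun w => F (φ w)) z = ∑ a, conj (dz i (fun w => φ w a) z) * dzbar a F (φ z) := by
  have hc : DifferentiableAt ℝ (fun w => F (φ w)) z := hF.comp z (hφ.restrictScalars ℝ)
  have h := congrArg conj (dz_comp i hφ (differentiableAt_conj hF))
  rw [dz_conj i hc, Complex.conj_conj] at h
  rw [h, map_sum]
  refine Finset.sum_congr rfl fun a _ => ?_
  rw [map_mul, dz_conj a hF, Complex.conj_conj]

theorem dz_cexp (i : Fin n) (hF : DifferentiableAt ℝ F z) :
    dz i (fun w => Complex.exp (F w)) z = Complex.exp (F z) * dz i F z := by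
  have h := fun v => congrArg (fun T => T v) hF.hasFDerivAt.cexp.fderiv
  simp only [smul_apply, smul_eq_mul] at h
  rw [dz, h, h, dz]
  ring

theorem contDiffOn_dz (i : Fin n) (hU : IsOpen U) (hF : ContDiffOn ℝ ∞ F U) :
    ContDiffOn ℝ ∞ (dz i F) U := by
  have h := hF.fderiv_of_isOpen (m := ∞) hU (by simp)
  exact contDiffOn_const.mul ((h.clm_apply contDiffOn_const).sub
    (contDiffOn_const.mul (h.clm_apply contDiffOn_const)))

theorem contDiffOn_dzbar (i : Fin n) (hU : IsOpen U) (hF : ContDiffOn ℝ ∞ F U) :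
    ContDiffOn ℝ ∞ (dzbar i F) U := by
  have h := hF.fderiv_of_isOpen (m := ∞) hU (by simp)
  exact contDiffOn_const.mul ((h.clm_apply contDiffOn_const).add
    (contDiffOn_const.mul (h.clm_apply contDiffOn_const)))

theorem ContDiffOn.differentiableAt_of_isOpen {𝕜 E E' : Type*} [NontriviallyNormedField 𝕜]
    [NormedAddCommGroup E] [NormedSpace 𝕜 E] [NormedAddCommGroup E'] [NormedSpace 𝕜 E']
    {f : E → E'} {s : Set E} {x : E} (hf : ContDiffOn 𝕜 ∞ f s) (hs : IsOpen s) (hx : x ∈ s) :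
    DifferentiableAt 𝕜 f x :=
  (hf.contDiffAt (hs.mem_nhds hx)).differentiableAt (by simp)

/-- The mixed Wirtinger derivatives commute. -/
theorem dz_dzbar_comm (i j : Fin n) (hU : IsOpen U) (hz : z ∈ U) (hF : ContDiffOn ℝ ∞ F U) :
    dz i (dzbar j F) z = dzbar j (dz i F) z := by
  have hd : DifferentiableAt ℝ (fderiv ℝ F) z :=
    (hF.fderiv_of_isOpen (m := ∞) hU (by simp)).differentiableAt_of_isOpen hU hz
  have hs : ∀ v w, fderiv ℝ (fderiv ℝ F) z v w = fderiv ℝ (fderiv ℝ F) z w v := fun v w =>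
    ((hF.contDiffAt (hU.mem_nhds hz)).isSymmSndFDerivAt (by simpa using ENat.LEInfty.out)).eq v w
  have hv : ∀ v, DifferentiableAt ℝ (fun w => fderiv ℝ F w v) z := fun v =>
    hd.clm_apply (differentiableAt_const v)
  have h2 : ∀ v w, fderiv ℝ (fun y => fderiv ℝ F y v) z w = fderiv ℝ (fderiv ℝ F) z w v := by
    intro v w
    rw [fderiv_clm_apply hd (differentiableAt_const v)]
    simp
  have e1 : ∀ v, fderiv ℝ (dzbar j F) z v = (1 / 2 : ℂ) *
      (fderiv ℝ (fderiv ℝ F) z v (Pi.single j 1) +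
        Complex.I * fderiv ℝ (fderiv ℝ F) z v (Pi.single j Complex.I)) := by
    intro v
    unfold dzbar
    rw [fderiv_const_mul ((hv _).fun_add ((hv _).const_mul _)),
      fderiv_fun_add (hv _) ((hv _).const_mul _), fderiv_const_mul (hv _)]
    simp [h2, mul_add]
  have e2 : ∀ v, fderiv ℝ (dz i F) z v = (1 / 2 : ℂ) *
      (fderiv ℝ (fderiv ℝ F) z v (Pi.single i 1) -
        Complex.I * fderiv ℝ (fderiv ℝ F) z v (Pi.single i Complex.I)) := by
    intro v
    unfold dz
    rw [fderiv_const_mul ((hv _).fun_sub ((hv _).const_mul _)),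
      fderiv_fun_sub (hv _) ((hv _).const_mul _), fderiv_const_mul (hv _)]
    simp [h2, mul_sub]
  rw [dz, dzbar, e1, e1, e2, e2, hs (Pi.single j 1), hs (Pi.single j 1),
    hs (Pi.single j Complex.I), hs (Pi.single j Complex.I)]
  ring

end Wirtinger

/-! ### Chern–Ricci form and complex Hessian under holomorphic coordinate changes -/

section MatrixCalculus

open Filter Topology Matrix

section Smoothness

variable {𝕜 E : Type*} [RCLike 𝕜] [NormedAlgebra 𝕜 ℂ] [NormedAddCommGroup E] [NormedSpace 𝕜 E]
  {n : ℕ} {A : E → Matrix (Fin n) (Fin n) ℂ} {U : Set E}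

theorem contDiffOn_det (hA : ∀ a b, ContDiffOn 𝕜 ∞ (fun w => A w a b) U) :
    ContDiffOn 𝕜 ∞ (fun w => (A w).det) U := by
  simp only [Matrix.det_apply']
  exact ContDiffOn.sum fun σ _ => contDiffOn_const.mul (contDiffOn_prod fun i _ => hA _ _)

theorem contDiffOn_matrix_inv (hA : ∀ a b, ContDiffOn 𝕜 ∞ (fun w => A w a b) U)
    (hdet : ∀ w ∈ U, (A w).det ≠ 0) (a b : Fin n) :
    ContDiffOn 𝕜 ∞ (fun w => (A w)⁻¹ a b) U := by
  have h : (fun w => (A w)⁻¹ a b) =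
      fun w => ((A w).det)⁻¹ * ((A w).updateRow b (Pi.single a 1)).det := by
    funext w
    rw [Matrix.inv_def, Matrix.smul_apply, Matrix.adjugate_apply, Ring.inverse_eq_inv, smul_eq_mul]
  rw [h]
  refine ((contDiffOn_det hA).inv hdet).mul (contDiffOn_det fun i j => ?_)
  simp only [Matrix.updateRow_apply]
  split_ifs
  · exact contDiffOn_const
  · exact hA i j

end Smoothness

variable {n : ℕ} {z : CSpace n} {U V : Set (CSpace n)}
  {A B G G' : CSpace n → Matrix (Fin n) (Fin n) ℂ} {F : CSpace n → ℂ} {φ : CSpace n → CSpace n}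

/-- The entrywise Wirtinger derivative `∂A/∂zⁱ` of a matrix of functions. -/
def dzMatrix (i : Fin n) (A : CSpace n → Matrix (Fin n) (Fin n) ℂ) (z : CSpace n) :
    Matrix (Fin n) (Fin n) ℂ :=
  Matrix.of fun a b => dz i (fun w => A w a b) z

/-- The function `tr (G⁻¹ ∂G/∂zⁱ)`, that is `∂(log det G)/∂zⁱ`. For the matrix `G` of a Hermitian
metric it is the trace `∑ Γ^k_{ik}` of the Christoffel symbols. -/
def dzLogDet (i : Fin n) (G : CSpace n → Matrix (Fin n) (Fin n) ℂ) (z : CSpace n) : ℂ :=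
  ((G z)⁻¹ * dzMatrix i G z).trace

/-- The Chern–Ricci curvature `-∂²(log det G)/∂zⁱ∂z̄ʲ` of the metric with matrix `G`. -/
def chernRicci (G : CSpace n → Matrix (Fin n) (Fin n) ℂ) (z : CSpace n) :
    Matrix (Fin n) (Fin n) ℂ :=
  Matrix.of fun i j => -dzbar j (dzLogDet i G) z

/-- The matrix `∂²F/∂zⁱ∂z̄ʲ`. -/
def complexHessian (F : CSpace n → ℂ) (z : CSpace n) : Matrix (Fin n) (Fin n) ℂ :=
  Matrix.of fun i j => dz i (dzbar j F) z

/-- The complex Jacobian matrix `∂φᵃ/∂zⁱ`, with row index `a` and column index `i`. -/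
def complexJacobian (φ : CSpace n → CSpace n) (z : CSpace n) : Matrix (Fin n) (Fin n) ℂ :=
  Matrix.of fun a i => dz i (fun w => φ w a) z

theorem dzMatrix_congr (i : Fin n) (h : A =ᶠ[𝓝 z] B) : dzMatrix i A z = dzMatrix i B z := by
  ext a b
  exact dz_congr i (h.mono fun w hw => congrFun (congrFun hw a) b)

theorem dzMatrix_mul (i : Fin n) (hA : ∀ a b, DifferentiableAt ℝ (fun w => A w a b) z)
    (hB : ∀ a b, DifferentiableAt ℝ (fun w => B w a b) z) :
    dzMatrix i (fun w => A w * B w) z = dzMatrix i A z * B z + A z * dzMatrix i B z := by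
  ext a b
  simp only [dzMatrix, Matrix.of_apply, Matrix.mul_apply, Matrix.add_apply]
  rw [dz_sum _ _ fun c _ => (hA a c).fun_mul (hB c b), ← Finset.sum_add_distrib]
  exact Finset.sum_congr rfl fun c _ => dz_mul i (hA a c) (hB c b)

theorem contDiffOn_dzLogDet (i : Fin n) (hU : IsOpen U)
    (hG : ∀ a b, ContDiffOn ℝ ∞ (fun w => G w a b) U) (hdet : ∀ w ∈ U, (G w).det ≠ 0) :
    ContDiffOn ℝ ∞ (dzLogDet i G) U := by
  unfold dzLogDet
  simp only [Matrix.trace, Matrix.diag, Matrix.mul_apply]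
  exact ContDiffOn.sum fun a _ => ContDiffOn.sum fun b _ =>
    (contDiffOn_matrix_inv hG hdet a b).mul (contDiffOn_dz i hU (hG b a))

theorem contDiffOn_dz_of_holomorphic (i : Fin n) (hU : IsOpen U) (hF : ContDiffOn ℂ ∞ F U) :
    ContDiffOn ℂ ∞ (dz i F) U :=
  ((hF.fderiv_of_isOpen (m := ∞) hU (by simp)).clm_apply
    (contDiffOn_const (c := (Pi.single i 1 : CSpace n)))).congr
    fun _ hw => dz_of_holomorphic i (hF.differentiableAt_of_isOpen hU hw)

/-- The logarithmic derivative of the determinant of a matrix of holomorphic functions is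
holomorphic: `log |det A|²` is pluriharmonic. -/
theorem contDiffOn_dzLogDet_of_holomorphic (i : Fin n) (hU : IsOpen U)
    (hA : ∀ a b, ContDiffOn ℂ ∞ (fun w => A w a b) U) (hdet : ∀ w ∈ U, (A w).det ≠ 0) :
    ContDiffOn ℂ ∞ (dzLogDet i A) U := by
  unfold dzLogDet
  simp only [Matrix.trace, Matrix.diag, Matrix.mul_apply]
  exact ContDiffOn.sum fun a _ => ContDiffOn.sum fun b _ =>
    (contDiffOn_matrix_inv hA hdet a b).mul (contDiffOn_dz_of_holomorphic i hU (hA b a))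

theorem contDiffOn_complexJacobian (hU : IsOpen U) (hφ : ContDiffOn ℂ ∞ φ U) (a i : Fin n) :
    ContDiffOn ℂ ∞ (fun w => complexJacobian φ w a i) U :=
  contDiffOn_dz_of_holomorphic i hU (contDiffOn_pi.1 hφ a)

/-- The contraction of a `(1,1)`-form with the inverse metric does not depend on coordinates. -/
theorem trace_inv_mul_of_congruence {J K X Y Z : Matrix (Fin n) (Fin n) ℂ} (hX : X = J * Y * K)
    (hdet : X.det ≠ 0) : (X⁻¹ * (J * Z * K)).trace = (Y⁻¹ * Z).trace := by
  subst hX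
  rw [Matrix.det_mul, Matrix.det_mul] at hdet
  have hK : IsUnit K.det := isUnit_iff_ne_zero.2 (right_ne_zero_of_mul hdet)
  have hJ : IsUnit J.det := isUnit_iff_ne_zero.2 (left_ne_zero_of_mul (left_ne_zero_of_mul hdet))
  rw [Matrix.mul_inv_rev, Matrix.mul_inv_rev]
  have : K⁻¹ * (Y⁻¹ * J⁻¹) * (J * Z * K) = K⁻¹ * (Y⁻¹ * Z * K) := by
    simp only [Matrix.mul_assoc, Matrix.nonsing_inv_mul_cancel_left J _ hJ]
  rw [this, Matrix.trace_mul_comm, Matrix.mul_assoc, Matrix.mul_nonsing_inv K hK, Matrix.mul_one]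

/-- The transformation rule of `∂(log det G)/∂zⁱ` under a holomorphic coordinate change. -/
theorem dzLogDet_comp (i : Fin n) (hU : IsOpen U) (hV : IsOpen V) (hφ : ContDiffOn ℂ ∞ φ U)
    (hUV : MapsTo φ U V) (hG' : ∀ a b, ContDiffOn ℝ ∞ (fun w => G' w a b) V)
    (hG : ∀ w ∈ U, G w = (complexJacobian φ w)ᵀ * G' (φ w) * (complexJacobian φ w).map conj)
    (hdet : ∀ w ∈ U, (G w).det ≠ 0) (hz : z ∈ U) :
    dzLogDet i G z = dzLogDet i (fun w => (complexJacobian φ w)ᵀ) z +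
      ∑ a, complexJacobian φ z a i * dzLogDet a G' (φ z) := by
  have hJ : ∀ a b, DifferentiableAt ℂ (fun w => complexJacobian φ w a b) z := fun a b =>
    (contDiffOn_complexJacobian hU hφ a b).differentiableAt_of_isOpen hU hz
  have hJR : ∀ a b, DifferentiableAt ℝ (fun w => complexJacobian φ w a b) z := fun a b =>
    (hJ a b).restrictScalars ℝ
  have hφz : DifferentiableAt ℂ φ z := hφ.differentiableAt_of_isOpen hU hz
  have hG'z : ∀ a b, DifferentiableAt ℝ (fun w => G' w a b) (φ z) := fun a b =>
    (hG' a b).differentiableAt_of_isOpen hV (hUV hz)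
  have hGc : ∀ a b, DifferentiableAt ℝ (fun w => G' (φ w) a b) z := fun a b =>
    (hG'z a b).comp z (hφz.restrictScalars ℝ)
  have hJT : ∀ a b, DifferentiableAt ℝ (fun w => (complexJacobian φ w)ᵀ a b) z := fun a b =>
    hJR b a
  have hK : ∀ a b, DifferentiableAt ℝ (fun w => (complexJacobian φ w).map conj a b) z :=
    fun a b => differentiableAt_conj (hJR a b)
  have hK0 : dzMatrix i (fun w => (complexJacobian φ w).map conj) z = 0 := by
    ext a b
    simp only [dzMatrix, Matrix.of_apply, Matrix.map_apply, Matrix.zero_apply]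
    rw [dz_conj i (hJR a b), dzbar_of_holomorphic i (hJ a b), map_zero]
  have hGφ : dzMatrix i (fun w => G' (φ w)) z =
      ∑ a, complexJacobian φ z a i • dzMatrix a G' (φ z) := by
    ext b c
    simp only [dzMatrix, Matrix.of_apply, Matrix.sum_apply, Matrix.smul_apply, smul_eq_mul,
      complexJacobian]
    exact dz_comp i hφz (hG'z b c)
  have hAB : ∀ a b, DifferentiableAt ℝ
      (fun w => ((complexJacobian φ w)ᵀ * G' (φ w)) a b) z := by
    intro a b
    simp only [Matrix.mul_apply]
    exact DifferentiableAt.fun_sum fun c _ => (hJT a c).mul (hGc c b)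
  have hD : dzMatrix i G z =
      (complexJacobian φ z)ᵀ * (((complexJacobian φ z)ᵀ)⁻¹ *
        dzMatrix i (fun w => (complexJacobian φ w)ᵀ) z * G' (φ z)) *
          (complexJacobian φ z).map conj +
      (complexJacobian φ z)ᵀ * (∑ a, complexJacobian φ z a i • dzMatrix a G' (φ z)) *
          (complexJacobian φ z).map conj := by
    have hdJ : IsUnit ((complexJacobian φ z)ᵀ).det := by
      have := hdet z hz
      rw [hG z hz, Matrix.det_mul, Matrix.det_mul] at this
      exact isUnit_iff_ne_zero.2 (left_ne_zero_of_mul (left_ne_zero_of_mul this))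
    rw [dzMatrix_congr i (eventually_of_mem (hU.mem_nhds hz) hG), dzMatrix_mul i hAB hK, hK0,
      dzMatrix_mul i hJT hGc, hGφ, Matrix.mul_zero, add_zero, Matrix.add_mul,
      Matrix.mul_assoc ((complexJacobian φ z)ᵀ)⁻¹, Matrix.mul_nonsing_inv_cancel_left _ _ hdJ]
  have hdG : IsUnit (G' (φ z)).det := by
    have := hdet z hz
    rw [hG z hz, Matrix.det_mul, Matrix.det_mul] at this
    exact isUnit_iff_ne_zero.2 (right_ne_zero_of_mul (left_ne_zero_of_mul this))
  rw [dzLogDet, hD, Matrix.mul_add, Matrix.trace_add,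
    trace_inv_mul_of_congruence (hG z hz) (hdet z hz),
    trace_inv_mul_of_congruence (hG z hz) (hdet z hz), Matrix.trace_mul_comm,
    Matrix.mul_nonsing_inv_cancel_right _ _ hdG, Matrix.mul_sum, Matrix.trace_sum]
  simp only [Matrix.mul_smul, Matrix.trace_smul, smul_eq_mul]
  rfl

/-- The Chern–Ricci curvature is a `(1,1)`-form. -/
theorem chernRicci_comp (hU : IsOpen U) (hV : IsOpen V) (hφ : ContDiffOn ℂ ∞ φ U)
    (hUV : MapsTo φ U V) (hG' : ∀ a b, ContDiffOn ℝ ∞ (fun w => G' w a b) V)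
    (hdet' : ∀ w ∈ V, (G' w).det ≠ 0)
    (hG : ∀ w ∈ U, G w = (complexJacobian φ w)ᵀ * G' (φ w) * (complexJacobian φ w).map conj)
    (hdet : ∀ w ∈ U, (G w).det ≠ 0) (hz : z ∈ U) :
    chernRicci G z =
      (complexJacobian φ z)ᵀ * chernRicci G' (φ z) * (complexJacobian φ z).map conj := by
  have hφz : DifferentiableAt ℂ φ z := hφ.differentiableAt_of_isOpen hU hz
  have hJ : ∀ a b, DifferentiableAt ℂ (fun w => complexJacobian φ w a b) z := fun a b =>
    (contDiffOn_complexJacobian hU hφ a b).differentiableAt_of_isOpen hU hz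
  have hL : ∀ a, DifferentiableAt ℝ (dzLogDet a G') (φ z) := fun a =>
    (contDiffOn_dzLogDet a hV hG' hdet').differentiableAt_of_isOpen hV (hUV hz)
  have hLφ : ∀ a, DifferentiableAt ℝ (fun w => dzLogDet a G' (φ w)) z := fun a =>
    (hL a).comp z (hφz.restrictScalars ℝ)
  have hJT : ∀ i, DifferentiableAt ℂ (dzLogDet i (fun w => (complexJacobian φ w)ᵀ)) z := by
    intro i
    refine (contDiffOn_dzLogDet_of_holomorphic i hU
      (fun a b => contDiffOn_complexJacobian hU hφ b a) fun w hw => ?_).differentiableAt_of_isOpen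
        hU hz
    have := hdet w hw
    rw [hG w hw, Matrix.det_mul, Matrix.det_mul] at this
    exact left_ne_zero_of_mul (left_ne_zero_of_mul this)
  ext i j
  have h : dzbar j (dzLogDet i G) z = ∑ a, complexJacobian φ z a i *
      ∑ b, conj (complexJacobian φ z b j) * dzbar b (dzLogDet a G') (φ z) := by
    rw [dzbar_congr j (eventually_of_mem (hU.mem_nhds hz) fun w hw =>
      dzLogDet_comp i hU hV hφ hUV hG' hG hdet hw),
      dzbar_add j ((hJT i).restrictScalars ℝ) (DifferentiableAt.fun_sum fun a _ =>
        ((hJ a i).restrictScalars ℝ).fun_mul (hLφ a)), dzbar_of_holomorphic j (hJT i), zero_add,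
      dzbar_sum _ _ fun a _ => ((hJ a i).restrictScalars ℝ).fun_mul (hLφ a)]
    refine Finset.sum_congr rfl fun a _ => ?_
    rw [dzbar_mul j ((hJ a i).restrictScalars ℝ) (hLφ a), dzbar_of_holomorphic j (hJ a i),
      zero_mul, zero_add, dzbar_comp j hφz (hL a)]
    rfl
  simp only [chernRicci, Matrix.of_apply, Matrix.mul_apply, Matrix.transpose_apply,
    Matrix.map_apply, h, Finset.mul_sum, Finset.sum_mul]
  rw [Finset.sum_comm, ← Finset.sum_neg_distrib]
  refine Finset.sum_congr rfl fun b _ => ?_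
  rw [← Finset.sum_neg_distrib]
  exact Finset.sum_congr rfl fun a _ => by ring

/-- The complex Hessian of a function is a `(1,1)`-form. -/
theorem complexHessian_comp (hU : IsOpen U) (hV : IsOpen V) (hφ : ContDiffOn ℂ ∞ φ U)
    (hUV : MapsTo φ U V) (hF : ContDiffOn ℝ ∞ F V) (hz : z ∈ U) :
    complexHessian (fun w => F (φ w)) z =
      (complexJacobian φ z)ᵀ * complexHessian F (φ z) * (complexJacobian φ z).map conj := by
  have hφz : ∀ w ∈ U, DifferentiableAt ℂ φ w := fun w hw =>
    hφ.differentiableAt_of_isOpen hU hw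
  have hJ : ∀ a b, DifferentiableAt ℂ (fun w => complexJacobian φ w a b) z := fun a b =>
    (contDiffOn_complexJacobian hU hφ a b).differentiableAt_of_isOpen hU hz
  have hD : ∀ b, DifferentiableAt ℝ (dzbar b F) (φ z) := fun b =>
    (contDiffOn_dzbar b hV hF).differentiableAt_of_isOpen hV (hUV hz)
  have hDφ : ∀ b, DifferentiableAt ℝ (fun w => dzbar b F (φ w)) z := fun b =>
    (hD b).comp z ((hφz z hz).restrictScalars ℝ)
  have hK : ∀ a b, DifferentiableAt ℝ (fun w => conj (complexJacobian φ w a b)) z :=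
    fun a b => differentiableAt_conj ((hJ a b).restrictScalars ℝ)
  ext i j
  have h : dz i (dzbar j fun w => F (φ w)) z = ∑ b, conj (complexJacobian φ z b j) *
      ∑ a, complexJacobian φ z a i * dz a (dzbar b F) (φ z) := by
    have h1 : ∀ w ∈ U, dzbar j (fun w => F (φ w)) w =
        ∑ b, conj (complexJacobian φ w b j) * dzbar b F (φ w) := fun w hw =>
      dzbar_comp j (hφz w hw) (hF.differentiableAt_of_isOpen hV (hUV hw))
    rw [dz_congr i (eventually_of_mem (hU.mem_nhds hz) h1),
      dz_sum _ _ fun b _ => (hK b j).fun_mul (hDφ b)]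
    refine Finset.sum_congr rfl fun b _ => ?_
    rw [dz_mul i (hK b j) (hDφ b), dz_conj i ((hJ b j).restrictScalars ℝ),
      dzbar_of_holomorphic i (hJ b j), map_zero, zero_mul, zero_add,
      dz_comp i (hφz z hz) (hD b)]
    rfl
  simp only [complexHessian, Matrix.of_apply, Matrix.mul_apply, Matrix.transpose_apply,
    Matrix.map_apply, h, Finset.mul_sum, Finset.sum_mul]
  exact Finset.sum_congr rfl fun b _ => Finset.sum_congr rfl fun a _ => by ring

theorem inv_exp_smul {A : Matrix (Fin n) (Fin n) ℂ} (hA : A.det ≠ 0) (c : ℂ) :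
    (Complex.exp c • A)⁻¹ = (Complex.exp c)⁻¹ • A⁻¹ := by
  apply Matrix.inv_eq_left_inv
  rw [Matrix.smul_mul, Matrix.mul_smul, smul_smul, inv_mul_cancel₀ (Complex.exp_ne_zero _),
    one_smul, Matrix.nonsing_inv_mul _ (isUnit_iff_ne_zero.2 hA)]

/-- Scaling by `e^F` adds `n ∂F/∂zⁱ` to `∂(log det G)/∂zⁱ`. -/
theorem dzLogDet_exp_smul (i : Fin n) (hF : DifferentiableAt ℝ F z)
    (hG : ∀ a b, DifferentiableAt ℝ (fun w => G w a b) z) (hdet : (G z).det ≠ 0) :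
    dzLogDet i (fun w => Complex.exp (F w) • G w) z = dzLogDet i G z + n * dz i F z := by
  have hD : dzMatrix i (fun w => Complex.exp (F w) • G w) z =
      Complex.exp (F z) • (dz i F z • G z + dzMatrix i G z) := by
    ext a b
    simp only [dzMatrix, Matrix.of_apply, Matrix.smul_apply, Matrix.add_apply, smul_eq_mul]
    rw [dz_mul i hF.cexp (hG a b), dz_cexp i hF]
    ring
  rw [dzLogDet, hD, inv_exp_smul hdet, Matrix.smul_mul, Matrix.mul_smul, smul_smul,
    inv_mul_cancel₀ (Complex.exp_ne_zero _), one_smul, Matrix.mul_add, Matrix.trace_add,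
    Matrix.mul_smul, Matrix.nonsing_inv_mul _ (isUnit_iff_ne_zero.2 hdet), Matrix.trace_smul,
    Matrix.trace_one, Fintype.card_fin, smul_eq_mul, dzLogDet]
  ring

/-- The Chern–Ricci curvature of `e^F G` is that of `G` minus `n √-1∂∂̄F`. -/
theorem chernRicci_exp_smul (hU : IsOpen U) (hF : ContDiffOn ℝ ∞ F U)
    (hG : ∀ a b, ContDiffOn ℝ ∞ (fun w => G w a b) U) (hdet : ∀ w ∈ U, (G w).det ≠ 0)
    (hz : z ∈ U) :
    chernRicci (fun w => Complex.exp (F w) • G w) z =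
      chernRicci G z - (n : ℂ) • complexHessian F z := by
  ext i j
  have h1 : ∀ w ∈ U, dzLogDet i (fun w => Complex.exp (F w) • G w) w =
      dzLogDet i G w + n * dz i F w := fun w hw =>
    dzLogDet_exp_smul i (hF.differentiableAt_of_isOpen hU hw)
      (fun a b => (hG a b).differentiableAt_of_isOpen hU hw) (hdet w hw)
  have h2 : DifferentiableAt ℝ (dz i F) z :=
    (contDiffOn_dz i hU hF).differentiableAt_of_isOpen hU hz
  simp only [chernRicci, complexHessian, Matrix.of_apply, Matrix.sub_apply, Matrix.smul_apply,
    smul_eq_mul]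
  rw [dzbar_congr j (eventually_of_mem (hU.mem_nhds hz) h1),
    dzbar_add j ((contDiffOn_dzLogDet i hU hG hdet).differentiableAt_of_isOpen hU hz)
      (h2.const_mul _), dzbar_const_mul j _ h2, dz_dzbar_comm i j hU hz hF]
  ring

end MatrixCalculus

/-! ### The Chern scalar curvature and the complex Laplacian as functions on the manifold -/

namespace HermitianMetric

open Filter Topology Matrix

variable {n : ℕ} {M : Type*} [TopologicalSpace M] [ChartedSpace (CSpace n) M]

/-- Moves the metric between two expressions for one point; all tangent spaces are `ℂⁿ` by
definition, so the vectors need no transport. -/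
theorem form_congr (g : HermitianMetric n M) {x y : M} (h : x = y) (u v : CSpace n) :
    g.form x u v = g.form y u v := by
  subst h; rfl

theorem form_mfderiv_symm (g : HermitianMetric n M) (e : OpenPartialHomeomorph M (CSpace n))
    (z v w : CSpace n) :
    g.form (e.symm z) (mfderiv 𝓘(ℂ, CSpace n) 𝓘(ℂ, CSpace n) e.symm z v)
      (mfderiv 𝓘(ℂ, CSpace n) 𝓘(ℂ, CSpace n) e.symm z w) =
      ∑ a, ∑ b, v a * g.coeff e z a b * conj (w b) := by
  have h : ∀ u : CSpace n, u = ∑ a, u a • (Pi.single a 1 : CSpace n) := fun u => by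
    conv_lhs => rw [← Finset.univ_sum_single u]
    exact Finset.sum_congr rfl fun a _ => by rw [← Pi.single_smul]; simp
  set D : CSpace n →L[ℂ] CSpace n := mfderiv 𝓘(ℂ, CSpace n) 𝓘(ℂ, CSpace n) e.symm z with hD
  have hDs : ∀ u : CSpace n, D u = ∑ a, u a • D (Pi.single a 1) := fun u => by
    conv_lhs => rw [h u]
    simp only [map_sum, map_smul]
  set B : CSpace n →ₗ[ℂ] CSpace n →ₗ⋆[ℂ] ℂ := g.form (e.symm z) with hB
  change B (D v) (D w) = ∑ a, ∑ b, v a * B (D (Pi.single a 1)) (D (Pi.single b 1)) * conj (w b)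
  rw [hDs v, hDs w]
  simp only [map_sum, LinearMap.sum_apply, map_smul, LinearMap.smul_apply, smul_eq_mul,
    LinearMap.map_smulₛₗ, Finset.mul_sum]
  rw [Finset.sum_comm]
  refine Finset.sum_congr rfl fun b _ => Finset.sum_congr rfl fun a _ => by ring

theorem boxChart_eq (g : HermitianMetric n M) (e : OpenPartialHomeomorph M (CSpace n))
    (f : M → ℝ) (z : CSpace n) :
    g.boxChart e f z =
      ((g.coeff e z)⁻¹ * complexHessian (fun w => (f (e.symm w) : ℂ)) z).trace := by
  simp only [boxChart, Matrix.trace, Matrix.diag, Matrix.mul_apply, invCoeff,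
    Matrix.transpose_apply, complexHessian, Matrix.of_apply]
  exact Finset.sum_comm

/-- A function given by chart expressions that agree under changes of charts is continuous. -/
theorem continuous_of_chart_expression
    (S : OpenPartialHomeomorph M (CSpace n) → CSpace n → ℂ)
    (hS : ∀ e ∈ atlas (CSpace n) M, ContinuousOn (S e) e.target)
    (hinv : ∀ e ∈ atlas (CSpace n) M, ∀ e' ∈ atlas (CSpace n) M,
      ∀ z ∈ (e.symm.trans e').source, S e z = S e' (e' (e.symm z))) :
    Continuous fun x : M => (S (chartAt (CSpace n) x) (chartAt (CSpace n) x x)).re := by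
  rw [continuous_iff_continuousAt]
  intro x₀
  set e₀ := chartAt (CSpace n) x₀
  have hx₀ : x₀ ∈ e₀.source := mem_chart_source _ x₀
  have h : ContinuousAt (fun x => (S e₀ (e₀ x)).re) x₀ :=
    Complex.continuous_re.continuousAt.comp
      (ContinuousAt.comp (f := e₀) ((hS e₀ (chart_mem_atlas _ x₀)).continuousAt
        (e₀.open_target.mem_nhds (e₀.map_source hx₀))) (e₀.continuousAt hx₀))
  refine h.congr (eventually_of_mem (e₀.open_source.mem_nhds hx₀) fun x hx => ?_)
  have hx' := e₀.left_inv hx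
  have hmem : e₀ x ∈ (e₀.symm.trans (chartAt (CSpace n) x)).source := by
    simp only [OpenPartialHomeomorph.trans_source, mem_inter_iff, mem_preimage,
      OpenPartialHomeomorph.symm_source]
    exact ⟨e₀.map_source hx, by rw [hx']; exact mem_chart_source _ x⟩
  have := hinv e₀ (chart_mem_atlas _ x₀) _ (chart_mem_atlas _ x) _ hmem
  rw [hx'] at this
  exact congrArg Complex.re this

variable [IsManifold 𝓘(ℂ, CSpace n) ω M] {e e' : OpenPartialHomeomorph M (CSpace n)}
  (g : HermitianMetric n M)

theorem contDiffOn_chart_change (he : e ∈ atlas (CSpace n) M) (he' : e' ∈ atlas (CSpace n) M) :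
    ContDiffOn ℂ ∞ (fun z => e' (e.symm z)) (e.symm.trans e').source := by
  have h := (contDiffGroupoid ω 𝓘(ℂ, CSpace n)).compatible he he'
  exact (contMDiffOn_iff_contDiffOn.1 (contMDiffOn_of_mem_contDiffGroupoid h)).of_le le_top

theorem mdifferentiable_atlas (he : e ∈ atlas (CSpace n) M) :
    e.MDifferentiable 𝓘(ℂ, CSpace n) 𝓘(ℂ, CSpace n) :=
  haveI : IsManifold 𝓘(ℂ, CSpace n) 1 M := IsManifold.of_le (n := ω) le_top
  mdifferentiable_of_mem_atlas he

/-- The coordinate vectors of two charts are related by the derivative of the chart change. The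
ascriptions identify the tangent spaces at the equal points `e.symm z` and
`e'.symm (e' (e.symm z))` with `ℂⁿ`. -/
theorem mfderiv_symm_chart_change (he : e ∈ atlas (CSpace n) M) (he' : e' ∈ atlas (CSpace n) M)
    {z : CSpace n} (hz : z ∈ (e.symm.trans e').source) (v : CSpace n) :
    (mfderiv 𝓘(ℂ, CSpace n) 𝓘(ℂ, CSpace n) e.symm z v : CSpace n) =
      (mfderiv 𝓘(ℂ, CSpace n) 𝓘(ℂ, CSpace n) e'.symm (e' (e.symm z))
        (fderiv ℂ (fun w => e' (e.symm w)) z v : CSpace n) : CSpace n) := by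
  have hU : IsOpen (e.symm.trans e').source := (e.symm.trans e').open_source
  have h1 : HasMFDerivAt 𝓘(ℂ, CSpace n) 𝓘(ℂ, CSpace n) (fun w => e' (e.symm w)) z
      (fderiv ℂ (fun w => e' (e.symm w)) z) :=
    ((contDiffOn_chart_change he he').differentiableAt_of_isOpen hU hz).hasFDerivAt.hasMFDerivAt
  have hz' : e' (e.symm z) ∈ e'.target := ((e.symm.trans e').map_source hz).1
  have h2 := ((mdifferentiable_atlas he').mdifferentiableAt_symm hz').hasMFDerivAt
  have h3 := (h2.comp z h1).congr_of_eventuallyEq (f₁ := e.symm)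
    (eventually_of_mem (hU.mem_nhds hz) fun w hw => by
      simp only [OpenPartialHomeomorph.trans_source, mem_inter_iff, mem_preimage] at hw
      exact (e'.left_inv hw.2).symm)
  exact congrArg (fun T : CSpace n →L[ℂ] CSpace n => T v) h3.mfderiv

theorem coeff_det_ne_zero (he : e ∈ atlas (CSpace n) M) {z : CSpace n} (hz : z ∈ e.target) :
    (g.coeff e z).det ≠ 0 := by
  intro h0
  obtain ⟨v, hv, hv0⟩ := Matrix.exists_vecMul_eq_zero_iff.2 h0
  have hinj := (mdifferentiable_atlas he).symm.mfderiv_injective hz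
  have h1 : g.form (e.symm z) (mfderiv 𝓘(ℂ, CSpace n) 𝓘(ℂ, CSpace n) e.symm z v)
      (mfderiv 𝓘(ℂ, CSpace n) 𝓘(ℂ, CSpace n) e.symm z v) = 0 := by
    rw [form_mfderiv_symm, Finset.sum_comm]
    refine Finset.sum_eq_zero fun b _ => ?_
    rw [← Finset.sum_mul]
    have : ∑ a, v a * g.coeff e z a b = 0 := congrFun hv0 b
    rw [this, zero_mul]
  have h2 := g.form_pos (e.symm z) (mfderiv 𝓘(ℂ, CSpace n) 𝓘(ℂ, CSpace n) e.symm z v)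
    fun h => hv (hinj (h.trans (map_zero _).symm))
  rw [h1] at h2
  simp at h2

/-- The transformation rule of the components of the metric under a change of charts. -/
theorem coeff_chart_change (he : e ∈ atlas (CSpace n) M) (he' : e' ∈ atlas (CSpace n) M)
    {z : CSpace n} (hz : z ∈ (e.symm.trans e').source) :
    g.coeff e z = (complexJacobian (fun w => e' (e.symm w)) z)ᵀ * g.coeff e' (e' (e.symm z)) *
      (complexJacobian (fun w => e' (e.symm w)) z).map conj := by
  have hφ : DifferentiableAt ℂ (fun w => e' (e.symm w)) z :=
    (contDiffOn_chart_change he he').differentiableAt_of_isOpen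
      (e.symm.trans e').open_source hz
  have hJ : ∀ a i, complexJacobian (fun w => e' (e.symm w)) z a i =
      fderiv ℂ (fun w => e' (e.symm w)) z (Pi.single i 1) a := by
    intro a i
    rw [complexJacobian, Matrix.of_apply, dz_of_holomorphic i (differentiableAt_pi.1 hφ a),
      fderiv_apply hφ]
    rfl
  have hx : e.symm z = e'.symm (e' (e.symm z)) := by
    simp only [OpenPartialHomeomorph.trans_source, mem_inter_iff, mem_preimage] at hz
    exact (e'.left_inv hz.2).symm
  ext i j
  have h1 : g.coeff e z i j = ∑ a, ∑ b, fderiv ℂ (fun w => e' (e.symm w)) z (Pi.single i 1) a *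
      g.coeff e' (e' (e.symm z)) a b *
      conj (fderiv ℂ (fun w => e' (e.symm w)) z (Pi.single j 1) b) := by
    rw [← form_mfderiv_symm]
    exact (g.form_congr hx _ _).trans
      (congrArg₂ (fun u v : CSpace n => g.form (e'.symm (e' (e.symm z))) u v)
        (mfderiv_symm_chart_change he he' hz _) (mfderiv_symm_chart_change he he' hz _))
  simp only [h1, Matrix.mul_apply, Matrix.transpose_apply, Matrix.map_apply, hJ, Finset.sum_mul]
  exact Finset.sum_comm

/-- Contracting `k` with `l` first, `g^{kl̄} g_{pl̄} = δ`, turns the Chern scalar curvature into the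
trace of the Chern–Ricci curvature. -/
theorem chernScalarChart_eq (he : e ∈ atlas (CSpace n) M) {z : CSpace n} (hz : z ∈ e.target) :
    g.chernScalarChart e z = ((g.coeff e z)⁻¹ * chernRicci (g.coeff e) z).trace := by
  have hdet : ∀ w ∈ e.target, (g.coeff e w).det ≠ 0 := fun w hw => g.coeff_det_ne_zero he hw
  have hΓ : ∀ p i k, DifferentiableAt ℝ (g.christoffel e p i k) z := by
    intro p i k
    unfold christoffel invCoeff
    exact DifferentiableAt.fun_sum fun q _ =>
      ((contDiffOn_matrix_inv (g.smooth e he) hdet q p).differentiableAt_of_isOpen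
        e.open_target hz).fun_mul
      ((contDiffOn_dz i e.open_target (g.smooth e he k q)).differentiableAt_of_isOpen
        e.open_target hz)
  have hone : ∀ k p, ∑ l, g.invCoeff e z k l * g.coeff e z p l =
      (1 : Matrix (Fin n) (Fin n) ℂ) p k := by
    intro k p
    rw [← Matrix.mul_nonsing_inv (g.coeff e z) (isUnit_iff_ne_zero.2 (hdet z hz)),
      Matrix.mul_apply]
    exact Finset.sum_congr rfl fun l _ => mul_comm _ _
  have htr : ∀ i, dzLogDet i (g.coeff e) = fun w => ∑ k, g.christoffel e k i k w := by
    intro i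
    funext w
    simp only [dzLogDet, Matrix.trace, Matrix.diag, Matrix.mul_apply, christoffel, invCoeff,
      Matrix.transpose_apply, dzMatrix, Matrix.of_apply]
    exact Finset.sum_comm
  have hcon : ∀ i j, ∑ k, ∑ l, g.invCoeff e z k l * g.chernCurvature e i j k l z =
      chernRicci (g.coeff e) z i j := by
    intro i j
    have h1 : ∀ k, ∑ l, g.invCoeff e z k l * g.chernCurvature e i j k l z =
        -dzbar j (g.christoffel e k i k) z := by
      intro k
      simp only [chernCurvature, Finset.mul_sum]
      rw [Finset.sum_comm]
      simp only [← mul_assoc, ← Finset.sum_mul, hone, Matrix.one_apply]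
      simp
    rw [Finset.sum_congr rfl fun k _ => h1 k, chernRicci, Matrix.of_apply, htr,
      dzbar_sum _ _ fun k _ => hΓ k i k, Finset.sum_neg_distrib]
  simp only [chernScalarChart, mul_assoc, ← Finset.mul_sum, hcon]
  simp only [Matrix.trace, Matrix.diag, Matrix.mul_apply, invCoeff, Matrix.transpose_apply]
  exact Finset.sum_comm

theorem chernScalarChart_chart_change (he : e ∈ atlas (CSpace n) M)
    (he' : e' ∈ atlas (CSpace n) M) {z : CSpace n} (hz : z ∈ (e.symm.trans e').source) :
    g.chernScalarChart e z = g.chernScalarChart e' (e' (e.symm z)) := by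
  have hz1 : z ∈ e.target := by
    simp only [OpenPartialHomeomorph.trans_source, mem_inter_iff] at hz
    exact hz.1
  have hmaps : MapsTo (fun w => e' (e.symm w)) (e.symm.trans e').source e'.target :=
    fun w hw => ((e.symm.trans e').map_source hw).1
  rw [g.chernScalarChart_eq he hz1, g.chernScalarChart_eq he' (hmaps hz),
    chernRicci_comp (G := g.coeff e) (G' := g.coeff e') (e.symm.trans e').open_source e'.open_target
      (contDiffOn_chart_change he he') hmaps (g.smooth e' he')
      (fun w hw => g.coeff_det_ne_zero he' hw) (fun w hw => g.coeff_chart_change he he' hw)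
      (fun w hw => g.coeff_det_ne_zero he
        (by simp only [OpenPartialHomeomorph.trans_source, mem_inter_iff] at hw; exact hw.1)) hz,
    trace_inv_mul_of_congruence (g.coeff_chart_change he he' hz) (g.coeff_det_ne_zero he hz1)]

theorem contDiffOn_ofReal_comp_chart_symm (f : C^∞⟮𝓘(ℝ, CSpace n), M; 𝓘(ℝ, ℝ), ℝ⟯)
    (he : e ∈ atlas (CSpace n) M) :
    ContDiffOn ℝ ∞ (fun z => (f (e.symm z) : ℂ)) e.target :=
  Complex.ofRealCLM.contDiff.comp_contDiffOn (contDiffOn_comp_chart_symm f e he)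

theorem boxChart_chart_change (f : C^∞⟮𝓘(ℝ, CSpace n), M; 𝓘(ℝ, ℝ), ℝ⟯)
    (he : e ∈ atlas (CSpace n) M)
    (he' : e' ∈ atlas (CSpace n) M) {z : CSpace n} (hz : z ∈ (e.symm.trans e').source) :
    g.boxChart e f z = g.boxChart e' f (e' (e.symm z)) := by
  have hz1 : z ∈ e.target := by
    simp only [OpenPartialHomeomorph.trans_source, mem_inter_iff] at hz
    exact hz.1
  have hmaps : MapsTo (fun w => e' (e.symm w)) (e.symm.trans e').source e'.target :=
    fun w hw => ((e.symm.trans e').map_source hw).1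
  have hU := (e.symm.trans e').open_source
  have hF : ∀ w ∈ (e.symm.trans e').source,
      (f (e.symm w) : ℂ) = (f (e'.symm (e' (e.symm w))) : ℂ) := by
    intro w hw
    simp only [OpenPartialHomeomorph.trans_source, mem_inter_iff, mem_preimage] at hw
    rw [e'.left_inv hw.2]
  have hH : complexHessian (fun w => (f (e.symm w) : ℂ)) z =
      complexHessian (fun w => (f (e'.symm (e' (e.symm w))) : ℂ)) z := by
    ext i j
    exact dz_congr i (eventually_of_mem (hU.mem_nhds hz) fun w hw =>
      dzbar_congr j (eventually_of_mem (hU.mem_nhds hw) hF))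
  rw [boxChart_eq, boxChart_eq, hH,
    complexHessian_comp (F := fun w => (f (e'.symm w) : ℂ)) hU e'.open_target
      (contDiffOn_chart_change he he') hmaps
      (contDiffOn_ofReal_comp_chart_symm f he') hz,
    trace_inv_mul_of_congruence (g.coeff_chart_change he he' hz) (g.coeff_det_ne_zero he hz1)]

theorem continuousOn_trace_inv_mul (he : e ∈ atlas (CSpace n) M)
    {R : CSpace n → Matrix (Fin n) (Fin n) ℂ}
    (hR : ∀ i j, ContinuousOn (fun z => R z i j) e.target) :
    ContinuousOn (fun z => ((g.coeff e z)⁻¹ * R z).trace) e.target := by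
  simp only [Matrix.trace, Matrix.diag, Matrix.mul_apply]
  exact continuousOn_finsetSum _ fun a _ => continuousOn_finsetSum _ fun b _ =>
    (contDiffOn_matrix_inv (𝕜 := ℝ) (g.smooth e he)
      (fun w hw => g.coeff_det_ne_zero he hw) a b).continuousOn.mul (hR b a)

theorem continuousOn_chernScalarChart (he : e ∈ atlas (CSpace n) M) :
    ContinuousOn (g.chernScalarChart e) e.target :=
  (g.continuousOn_trace_inv_mul he fun i j => (contDiffOn_dzbar j e.open_target
    (contDiffOn_dzLogDet i e.open_target (g.smooth e he)
      fun _ hw => g.coeff_det_ne_zero he hw)).continuousOn.neg).congr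
    fun _ hz => g.chernScalarChart_eq he hz

theorem continuousOn_boxChart (f : C^∞⟮𝓘(ℝ, CSpace n), M; 𝓘(ℝ, ℝ), ℝ⟯)
    (he : e ∈ atlas (CSpace n) M) : ContinuousOn (g.boxChart e f) e.target :=
  (g.continuousOn_trace_inv_mul he fun i j => (contDiffOn_dz i e.open_target
    (contDiffOn_dzbar j e.open_target (contDiffOn_ofReal_comp_chart_symm f he))).continuousOn).congr
    fun z _ => g.boxChart_eq e f z

/-- The Chern scalar curvature is evaluated in a chart that varies with the point; it is continuous
because its expression does not depend on the chart. -/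
theorem continuous_chernScalar : Continuous g.chernScalar :=
  continuous_of_chart_expression g.chernScalarChart
    (fun _ he => g.continuousOn_chernScalarChart he)
    fun _ he _ he' _ hz => g.chernScalarChart_chart_change he he' hz

theorem continuous_box (f : C^∞⟮𝓘(ℝ, CSpace n), M; 𝓘(ℝ, ℝ), ℝ⟯) : Continuous (g.box f) :=
  continuous_of_chart_expression (fun e => g.boxChart e f)
    (fun _ he => g.continuousOn_boxChart f he)
    fun _ he _ he' _ hz => g.boxChart_chart_change f he he' hz

/-! ### Conformal change of the metric -/

theorem coeff_conformal (f : C^∞⟮𝓘(ℝ, CSpace n), M; 𝓘(ℝ, ℝ), ℝ⟯)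
    (e : OpenPartialHomeomorph M (CSpace n)) :
    (g.conformal f).coeff e = fun z => Complex.exp (f (e.symm z)) • g.coeff e z := by
  funext z
  rw [← Complex.ofReal_exp]
  rfl

/-- The Chern scalar curvature of `e^f g` is `e^{-f} (s_g - n □_g f)`. -/
theorem chernScalar_conformal (f : C^∞⟮𝓘(ℝ, CSpace n), M; 𝓘(ℝ, ℝ), ℝ⟯) (x : M) :
    (g.conformal f).chernScalar x = Real.exp (-f x) * (g.chernScalar x - n * g.box f x) := by
  set e := chartAt (CSpace n) x
  have he : e ∈ atlas (CSpace n) M := chart_mem_atlas _ x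
  have hx : x ∈ e.source := mem_chart_source _ x
  have hz : e x ∈ e.target := e.map_source hx
  have hdet := g.coeff_det_ne_zero he hz
  have h : (g.conformal f).chernScalarChart e (e x) =
      (Real.exp (-f x) : ℂ) * (g.chernScalarChart e (e x) - (n : ℂ) * g.boxChart e f (e x)) := by
    rw [chernScalarChart_eq _ he hz, chernScalarChart_eq _ he hz, boxChart_eq, coeff_conformal,
      chernRicci_exp_smul (G := g.coeff e) e.open_target (contDiffOn_ofReal_comp_chart_symm f he)
        (g.smooth e he) (fun w hw => g.coeff_det_ne_zero he hw) hz]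
    simp only [e.left_inv hx]
    rw [inv_exp_smul hdet, Matrix.smul_mul, Matrix.trace_smul, Matrix.mul_sub, Matrix.trace_sub,
      Matrix.mul_smul, Matrix.trace_smul, smul_eq_mul, smul_eq_mul, ← Complex.exp_neg,
      Complex.ofReal_exp, Complex.ofReal_neg]
  rw [chernScalar, h, Complex.re_ofReal_mul, Complex.sub_re, ← Complex.ofReal_natCast,
    Complex.re_ofReal_mul]
  rfl

theorem box_smul (t : ℝ) (f : C^∞⟮𝓘(ℝ, CSpace n), M; 𝓘(ℝ, ℝ), ℝ⟯) (x : M) :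
    g.box (t • f : C^∞⟮𝓘(ℝ, CSpace n), M; 𝓘(ℝ, ℝ), ℝ⟯) x = t * g.box f x := by
  set e := chartAt (CSpace n) x
  have he : e ∈ atlas (CSpace n) M := chart_mem_atlas _ x
  have hz : e x ∈ e.target := e.map_source (mem_chart_source _ x)
  have hF := contDiffOn_ofReal_comp_chart_symm f he
  have hH : complexHessian (fun w => ((t • f : C^∞⟮𝓘(ℝ, CSpace n), M; 𝓘(ℝ, ℝ), ℝ⟯)
      (e.symm w) : ℂ)) (e x) = (t : ℂ) • complexHessian (fun w => (f (e.symm w) : ℂ)) (e x) := by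
    ext i j
    have h0 : (fun w => ((t • f : C^∞⟮𝓘(ℝ, CSpace n), M; 𝓘(ℝ, ℝ), ℝ⟯) (e.symm w) : ℂ)) =
        fun w => (t : ℂ) * (f (e.symm w) : ℂ) := by
      funext w
      simp
    simp only [complexHessian, Matrix.of_apply, Matrix.smul_apply, smul_eq_mul, h0]
    rw [dz_congr i (eventually_of_mem (e.open_target.mem_nhds hz) fun w hw =>
      dzbar_const_mul j t (hF.differentiableAt_of_isOpen e.open_target hw)),
      dz_const_mul i t ((contDiffOn_dzbar j e.open_target hF).differentiableAt_of_isOpen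
        e.open_target hz)]
  rw [box, boxChart_eq, hH, Matrix.mul_smul, Matrix.trace_smul, smul_eq_mul,
    Complex.re_ofReal_mul, ← boxChart_eq]
  rfl

end HermitianMetric

/-! ### The volume measure -/

theorem MeasureTheory.Measure.withDensity_map {α β : Type*} [MeasurableSpace α]
    [MeasurableSpace β] {μ : Measure α} {T : α → β} {h : β → ENNReal} (hT : AEMeasurable T μ)
    (hh : Measurable h) : (μ.map T).withDensity h = (μ.withDensity (h ∘ T)).map T := by
  ext s hs
  have hT' : AEMeasurable T (μ.withDensity (h ∘ T)) :=
    hT.mono_ac (withDensity_absolutelyContinuous _ _)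
  have hTs : NullMeasurableSet (T ⁻¹' s) μ := hT.nullMeasurableSet_preimage hs
  rw [withDensity_apply _ hs, Measure.map_apply_of_aemeasurable hT' hs,
    withDensity_apply₀ _ hTs, Measure.restrict_map_of_aemeasurable hT hs,
    lintegral_map' hh.aemeasurable (hT.mono_measure Measure.restrict_le_self)]
  rfl

namespace HermitianMetric

variable {n : ℕ} {M : Type*} [TopologicalSpace M] [ChartedSpace (CSpace n) M]

theorem aemeasurable_chart_symm [MeasurableSpace M] [BorelSpace M] (x : M) :
    AEMeasurable (chartAt (CSpace n) x).symm
      (volume.restrict (chartAt (CSpace n) x).target) :=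
  (chartAt (CSpace n) x).continuousOn_symm.aemeasurable
    (chartAt (CSpace n) x).open_target.measurableSet

variable [CompactSpace M] [T2Space M]

/-- The density of the volume form in the chart at `x`, weighted by the partition of unity. -/
def volDensity (g : HermitianMetric n M) (x : M) (z : CSpace n) : ℝ :=
  chartPartition n M x ((chartAt (CSpace n) x).symm z) *
    (2 ^ n * (g.coeff (chartAt (CSpace n) x) z).det.re)

theorem continuousOn_volDensity (g : HermitianMetric n M) (x : M) :
    ContinuousOn (g.volDensity x) (chartAt (CSpace n) x).target :=
  ((chartPartition n M x).continuous.comp_continuousOn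
    (chartAt (CSpace n) x).continuousOn_symm).mul (continuousOn_const.mul
      (Complex.continuous_re.comp_continuousOn
        (contDiffOn_det (g.smooth _ (chart_mem_atlas _ x))).continuousOn))

theorem aemeasurable_volDensity (g : HermitianMetric n M) (x : M) :
    AEMeasurable (fun z => ENNReal.ofReal (g.volDensity x z))
      (volume.restrict (chartAt (CSpace n) x).target) :=
  ((g.continuousOn_volDensity x).aemeasurable
    (chartAt (CSpace n) x).open_target.measurableSet).ennreal_ofReal

variable [MeasurableSpace M] [BorelSpace M]

/-- The volume is finite: only finitely many members of the partition of unity are nonzero, and each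
is supported in a compact subset of its chart, on which the density is bounded. -/
theorem isFiniteMeasure_vol (g : HermitianMetric n M) : IsFiniteMeasure g.vol := by
  have hterm : ∀ x : M, (((volume.restrict (chartAt (CSpace n) x).target).withDensity fun z =>
      ENNReal.ofReal (g.volDensity x z)).map (chartAt (CSpace n) x).symm) univ < ⊤ := by
    intro x
    set e := chartAt (CSpace n) x
    have hK : IsCompact (e '' tsupport (chartPartition n M x)) :=
      (isClosed_tsupport _).isCompact.image_of_continuousOn
        (e.continuousOn.mono ((exists_chartPartition n M).choose_spec x))
    have hKt : e '' tsupport (chartPartition n M x) ⊆ e.target := by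
      rintro _ ⟨y, hy, rfl⟩
      exact e.map_source ((exists_chartPartition n M).choose_spec x hy)
    obtain ⟨C, hC⟩ := (hK.bddAbove_image ((g.continuousOn_volDensity x).mono hKt))
    rw [Measure.map_apply_of_aemeasurable ((aemeasurable_chart_symm x).mono_ac
      (withDensity_absolutelyContinuous _ _)) MeasurableSet.univ, preimage_univ,
      withDensity_apply _ MeasurableSet.univ, Measure.restrict_univ]
    calc ∫⁻ z in e.target, ENNReal.ofReal (g.volDensity x z)
        ≤ ∫⁻ z in e.target, (e '' tsupport (chartPartition n M x)).indicator
            (fun _ => ENNReal.ofReal C) z := by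
          refine setLIntegral_mono' e.open_target.measurableSet fun z hz => ?_
          by_cases hzK : z ∈ e '' tsupport (chartPartition n M x)
          · rw [indicator_of_mem hzK]
            exact ENNReal.ofReal_le_ofReal (hC (mem_image_of_mem _ hzK))
          · have h0 : chartPartition n M x (e.symm z) = 0 := by
              by_contra h
              exact hzK ⟨e.symm z, subset_tsupport _ h, e.right_inv hz⟩
            have : g.volDensity x z = 0 := by
              rw [volDensity, h0, zero_mul]
            simp [this]
      _ ≤ ∫⁻ z, (e '' tsupport (chartPartition n M x)).indicator
            (fun _ => ENNReal.ofReal C) z := setLIntegral_le_lintegral _ _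
      _ < ⊤ := by
          rw [lintegral_indicator_const hK.measurableSet]
          exact ENNReal.mul_lt_top ENNReal.ofReal_lt_top hK.measure_lt_top
  have hfin : {x : M | (Function.support (chartPartition n M x)).Nonempty}.Finite := by
    have := (chartPartition n M).locallyFinite.finite_nonempty_of_compact
    exact this
  constructor
  change Measure.sum _ univ < ⊤
  rw [Measure.sum_apply _ MeasurableSet.univ, tsum_eq_sum (s := hfin.toFinset)]
  · exact ENNReal.sum_lt_top.2 fun x _ => hterm x
  · intro x hx
    have h0 : ∀ y, chartPartition n M x y = 0 := by
      intro y
      by_contra h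
      exact hx (hfin.mem_toFinset.2 ⟨y, h⟩)
    simp [h0]

variable [IsManifold 𝓘(ℂ, CSpace n) ω M]

/-- The volume form of `e^f g` is `e^{nf}` times that of `g`. -/
theorem vol_conformal (g : HermitianMetric n M) (f : C^∞⟮𝓘(ℝ, CSpace n), M; 𝓘(ℝ, ℝ), ℝ⟯) :
    (g.conformal f).vol = g.vol.withDensity fun x => ENNReal.ofReal (Real.exp (n * f x)) := by
  have hmeas : Measurable fun x : M => ENNReal.ofReal (Real.exp (n * f x)) :=
    (Real.continuous_exp.comp
      (continuous_const.mul f.contMDiff.continuous)).measurable.ennreal_ofReal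
  unfold vol
  rw [withDensity_sum]
  congr 1
  funext x
  rw [Measure.withDensity_map ((aemeasurable_chart_symm x).mono_ac
    (withDensity_absolutelyContinuous _ _)) hmeas]
  congr 1
  have hm2 : AEMeasurable ((fun y : M => ENNReal.ofReal (Real.exp (n * f y))) ∘
      (chartAt (CSpace n) x).symm) (volume.restrict (chartAt (CSpace n) x).target) :=
    hmeas.comp_aemeasurable (aemeasurable_chart_symm x)
  refine Eq.trans ?_ (withDensity_mul₀ (g.aemeasurable_volDensity x) hm2)
  congr 1
  funext z
  have hdet : ((g.conformal f).coeff (chartAt (CSpace n) x) z).det.re =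
      Real.exp (n * f ((chartAt (CSpace n) x).symm z)) *
        (g.coeff (chartAt (CSpace n) x) z).det.re := by
    rw [coeff_conformal, Matrix.det_smul, Fintype.card_fin, ← Complex.exp_nat_mul,
      ← Complex.ofReal_natCast, ← Complex.ofReal_mul, ← Complex.ofReal_exp,
      Complex.re_ofReal_mul]
  simp only [Pi.mul_apply, Function.comp_apply, hdet]
  rw [mul_comm (ENNReal.ofReal _), ← ENNReal.ofReal_mul (Real.exp_pos _).le]
  congr 1
  ring

theorem integral_vol_conformal (g : HermitianMetric n M)
    (f : C^∞⟮𝓘(ℝ, CSpace n), M; 𝓘(ℝ, ℝ), ℝ⟯) (h : M → ℝ) :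
    ∫ x, h x ∂(g.conformal f).vol = ∫ x, Real.exp (n * f x) * h x ∂g.vol := by
  have hmeas : Measurable fun x : M => Real.exp (n * f x) :=
    (Real.continuous_exp.comp (continuous_const.mul f.contMDiff.continuous)).measurable
  rw [vol_conformal, integral_withDensity_eq_integral_toReal_smul hmeas.ennreal_ofReal
    (Filter.Eventually.of_forall fun _ => ENNReal.ofReal_lt_top)]
  refine integral_congr_ae (Filter.Eventually.of_forall fun x => ?_)
  simp only [ENNReal.toReal_ofReal (Real.exp_pos _).le, smul_eq_mul]

end HermitianMetric

/-! ### The first variation -/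

/-- The nonlinearity `s ↦ s |s|^{p-2}` is continuous, being `1/p` times the derivative of the
`C¹` function `|s|^p`; this includes the singular range `1 < p < 2`. -/
theorem continuous_mul_abs_rpow {p : ℝ} (hp : 1 < p) :
    Continuous fun s : ℝ => s * |s| ^ (p - 2) := by
  have h : Continuous (deriv fun s : ℝ => |s| ^ p) :=
    (contDiff_norm_rpow (E := ℝ) hp).continuous_deriv le_rfl
  have h2 : (fun s : ℝ => s * |s| ^ (p - 2)) = fun s => p⁻¹ * deriv (fun s : ℝ => |s| ^ p) s := by
    funext s
    rw [(hasDerivAt_abs_rpow s hp).deriv]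
    field_simp
  rw [h2]
  exact continuous_const.mul h

theorem Continuous.integrable_of_compactSpace {X : Type*} [TopologicalSpace X] [CompactSpace X]
    [MeasurableSpace X] [OpensMeasurableSpace X] {μ : Measure X} [IsFiniteMeasure μ] {u : X → ℝ}
    (hu : Continuous u) : Integrable u μ := by
  obtain ⟨C, hC⟩ := (isCompact_range hu).isBounded.exists_norm_le
  exact Integrable.of_bound hu.aestronglyMeasurable C
    (Filter.Eventually.of_forall fun x => hC _ (mem_range_self x))

/-- Differentiation under the integral sign over a compact space. -/
theorem hasDerivAt_integral_of_continuous {X : Type*} [TopologicalSpace X] [CompactSpace X]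
    [MeasurableSpace X] [OpensMeasurableSpace X] {μ : Measure X} [IsFiniteMeasure μ]
    {Φ Φ' : ℝ → X → ℝ} (hΦ : ∀ t, Continuous (Φ t)) (hΦ' : Continuous fun q : ℝ × X => Φ' q.1 q.2)
    (hd : ∀ t x, HasDerivAt (fun s => Φ s x) (Φ' t x) t) (t₀ : ℝ) :
    HasDerivAt (fun t => ∫ x, Φ t x ∂μ) (∫ x, Φ' t₀ x ∂μ) t₀ := by
  obtain ⟨C, hC⟩ := (((isCompact_Icc (a := t₀ - 1) (b := t₀ + 1)).prod
    (isCompact_univ (X := X))).image hΦ').isBounded.exists_norm_le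
  have hslice : Continuous (Φ' t₀) := hΦ'.comp (Continuous.prodMk_right t₀)
  refine (hasDerivAt_integral_of_dominated_loc_of_deriv_le (bound := fun _ => C)
    (Icc_mem_nhds (a := t₀ - 1) (b := t₀ + 1) (by linarith) (by linarith))
    (Filter.Eventually.of_forall fun t => (hΦ t).aestronglyMeasurable)
    (hΦ t₀).integrable_of_compactSpace hslice.aestronglyMeasurable
    (Filter.Eventually.of_forall fun x t ht => hC _ ⟨(t, x), ⟨ht, mem_univ _⟩, rfl⟩)
    (integrable_const C) (Filter.Eventually.of_forall fun x t _ => hd t x)).2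

namespace HermitianMetric

variable {n : ℕ} {M : Type*} [TopologicalSpace M] [CompactSpace M] [T2Space M]
  [MeasurableSpace M] [BorelSpace M] [ChartedSpace (CSpace n) M]
  (g : HermitianMetric n M)

theorem hasDerivAt_integral_exp (f : C^∞⟮𝓘(ℝ, CSpace n), M; 𝓘(ℝ, ℝ), ℝ⟯) :
    HasDerivAt (fun t : ℝ => ∫ x, Real.exp (n * f x * t) ∂g.vol)
      (n * ∫ x, f x ∂g.vol) 0 := by
  have := g.isFiniteMeasure_vol
  have hf : Continuous f := f.contMDiff.continuous
  refine (hasDerivAt_integral_of_continuous (μ := g.vol)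
    (Φ := fun t x => Real.exp (n * f x * t))
    (Φ' := fun t x => Real.exp (n * f x * t) * (n * f x * 1)) (fun t => by fun_prop)
    (by fun_prop) (fun t x => ((hasDerivAt_id t).const_mul (n * f x)).exp) 0).congr_deriv ?_
  rw [← integral_const_mul]
  simp

variable [IsManifold 𝓘(ℂ, CSpace n) ω M]

/-- Of the weights `e^{-ptf}` from `|s|^p` and `e^{ntf}` from the volume, `e^{(n-p)tf}` remains. -/
theorem calabi_conformal_smul (p : ℝ) (f : C^∞⟮𝓘(ℝ, CSpace n), M; 𝓘(ℝ, ℝ), ℝ⟯) (t : ℝ) :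
    (g.conformal (t • f)).calabi p =
      (∫ x, Real.exp ((n - p) * f x * t) * |g.chernScalar x - n * g.box f x * t| ^ p ∂g.vol) *
        (∫ x, Real.exp (n * f x * t) ∂g.vol) ^ (-((n - p) / n) : ℝ) := by
  rw [calabi, integral_vol_conformal, integral_vol_conformal]
  refine congrArg₂ (fun a b : ℝ => a * b ^ (-((n - p) / n) : ℝ)) ?_ ?_
  · refine integral_congr_ae (Filter.Eventually.of_forall fun x => ?_)
    have h0 : (t • f : C^∞⟮𝓘(ℝ, CSpace n), M; 𝓘(ℝ, ℝ), ℝ⟯) x = t * f x := rfl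
    simp only [chernScalar_conformal, box_smul, h0]
    rw [abs_mul, abs_of_pos (Real.exp_pos _), Real.mul_rpow (Real.exp_pos _).le (abs_nonneg _),
      ← Real.exp_mul, ← mul_assoc, ← Real.exp_add]
    congr 2
    · ring
    · ring_nf
  · refine integral_congr_ae (Filter.Eventually.of_forall fun x => ?_)
    have h0 : (t • f : C^∞⟮𝓘(ℝ, CSpace n), M; 𝓘(ℝ, ℝ), ℝ⟯) x = t * f x := rfl
    simp only [h0, mul_one]
    congr 1
    ring

theorem hasDerivAt_integral_abs_chernScalar_rpow {p : ℝ} (hp : 1 < p)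
    (f : C^∞⟮𝓘(ℝ, CSpace n), M; 𝓘(ℝ, ℝ), ℝ⟯) :
    HasDerivAt (fun t : ℝ => ∫ x, Real.exp ((n - p) * f x * t) *
        |g.chernScalar x - n * g.box f x * t| ^ p ∂g.vol)
      ((n - p) * ∫ x, |g.chernScalar x| ^ p * f x ∂g.vol -
        n * p * ∫ x, g.chernScalar x * |g.chernScalar x| ^ (p - 2) * g.box f x ∂g.vol) 0 := by
  have := g.isFiniteMeasure_vol
  have hf : Continuous f := f.contMDiff.continuous
  have hs := g.continuous_chernScalar
  have hb := g.continuous_box f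
  have hp0 : 0 ≤ p := by linarith
  have hψ := continuous_mul_abs_rpow hp
  have h := hasDerivAt_integral_of_continuous (μ := g.vol)
    (Φ := fun t x => Real.exp ((n - p) * f x * t) * |g.chernScalar x - n * g.box f x * t| ^ p)
    (Φ' := fun t x => (n - p) * f x * Real.exp ((n - p) * f x * t) *
        |g.chernScalar x - n * g.box f x * t| ^ p + Real.exp ((n - p) * f x * t) *
        (p * ((g.chernScalar x - n * g.box f x * t) *
          |g.chernScalar x - n * g.box f x * t| ^ (p - 2)) * -(n * g.box f x)))
    (fun t => by
      have : Continuous fun x => |g.chernScalar x - n * g.box f x * t| ^ p :=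
        Continuous.rpow_const (by fun_prop) fun _ => Or.inr hp0
      fun_prop)
    (by
      have h1 : Continuous fun q : ℝ × M => |g.chernScalar q.2 - n * g.box f q.2 * q.1| ^ p :=
        Continuous.rpow_const (by fun_prop) fun _ => Or.inr hp0
      have h2 : Continuous fun q : ℝ × M => (g.chernScalar q.2 - n * g.box f q.2 * q.1) *
          |g.chernScalar q.2 - n * g.box f q.2 * q.1| ^ (p - 2) :=
        hψ.comp (g := fun s : ℝ => s * |s| ^ (p - 2)) (by fun_prop)
      fun_prop)
    (fun t x => by
      have h1 : HasDerivAt (fun t : ℝ => Real.exp ((n - p) * f x * t))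
          (Real.exp ((n - p) * f x * t) * ((n - p) * f x * 1)) t :=
        ((hasDerivAt_id t).const_mul ((n - p) * f x)).exp
      have h2 : HasDerivAt (fun t : ℝ => g.chernScalar x - n * g.box f x * t)
          (-(n * g.box f x * 1)) t :=
        ((hasDerivAt_id t).const_mul (n * g.box f x)).const_sub (g.chernScalar x)
      refine (h1.fun_mul ((hasDerivAt_abs_rpow _ hp).comp t h2)).congr_deriv ?_
      simp only [Function.comp_apply]
      ring) 0
  refine h.congr_deriv ?_
  have hi1 : Integrable (fun x => |g.chernScalar x| ^ p * f x) g.vol :=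
    ((hs.abs.rpow_const fun _ => Or.inr hp0).mul hf).integrable_of_compactSpace
  have hi2 : Integrable
      (fun x => g.chernScalar x * |g.chernScalar x| ^ (p - 2) * g.box f x) g.vol :=
    ((hψ.comp hs).mul hb).integrable_of_compactSpace
  rw [← integral_const_mul, ← integral_const_mul,
    ← integral_sub (hi1.const_mul _) (hi2.const_mul _)]
  refine integral_congr_ae (Filter.Eventually.of_forall fun x => ?_)
  simp only [mul_zero, Real.exp_zero, sub_zero]
  ring

/-- The first variation of the normalized `p`-Calabi functional along `e^{tf} g`. -/
theorem hasDerivAt_calabi_conformal (hn : n ≠ 0) {p : ℝ} (hp : 1 < p)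
    (hV : ∫ _, (1 : ℝ) ∂g.vol ≠ 0) (f : C^∞⟮𝓘(ℝ, CSpace n), M; 𝓘(ℝ, ℝ), ℝ⟯) :
    HasDerivAt (fun t : ℝ => (g.conformal (t • f)).calabi p)
      ((∫ _, (1 : ℝ) ∂g.vol) ^ (-((n - p) / n) : ℝ) *
        ((n - p) * (∫ x, |g.chernScalar x| ^ p * f x ∂g.vol -
          (∫ x, |g.chernScalar x| ^ p ∂g.vol) / (∫ _, (1 : ℝ) ∂g.vol) * ∫ x, f x ∂g.vol) -
        n * p * ∫ x, g.chernScalar x * |g.chernScalar x| ^ (p - 2) * g.box f x ∂g.vol)) 0 := by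
  have hn' : (n : ℝ) ≠ 0 := Nat.cast_ne_zero.2 hn
  have hW0 : ∫ x, Real.exp (n * f x * (0 : ℝ)) ∂g.vol = ∫ _, (1 : ℝ) ∂g.vol := by simp
  have hV0 : 0 < ∫ _, (1 : ℝ) ∂g.vol :=
    lt_of_le_of_ne (integral_nonneg fun _ => zero_le_one) hV.symm
  have h := (g.hasDerivAt_integral_abs_chernScalar_rpow hp f).fun_mul
    ((g.hasDerivAt_integral_exp f).rpow_const (p := (-((n - p) / n) : ℝ))
      (Or.inl (by rw [hW0]; exact hV)))
  simp only [← g.calabi_conformal_smul p f] at h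
  refine h.congr_deriv ?_
  rw [hW0, Real.rpow_sub_one hV]
  simp only [mul_zero, Real.exp_zero, sub_zero, one_mul]
  field_simp
  ring

theorem toDistribution_sub_average {p : ℝ} (hp : 1 < p)
    (c : ℝ) (f : C^∞⟮𝓘(ℝ, CSpace n), M; 𝓘(ℝ, ℝ), ℝ⟯) :
    g.toDistribution (fun x => c *
      (|g.chernScalar x| ^ p - ⨍ y, |g.chernScalar y| ^ p ∂g.vol)) f =
      c * (∫ x, |g.chernScalar x| ^ p * f x ∂g.vol -
        (∫ x, |g.chernScalar x| ^ p ∂g.vol) / (∫ _, (1 : ℝ) ∂g.vol) * ∫ x, f x ∂g.vol) := by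
  have := g.isFiniteMeasure_vol
  have hf : Continuous f := f.contMDiff.continuous
  have hi1 : Integrable (fun x => |g.chernScalar x| ^ p * f x) g.vol :=
    ((g.continuous_chernScalar.abs.rpow_const fun _ => Or.inr (by linarith)).mul
      hf).integrable_of_compactSpace
  have havg : ⨍ y, |g.chernScalar y| ^ p ∂g.vol =
      (∫ x, |g.chernScalar x| ^ p ∂g.vol) / (∫ _, (1 : ℝ) ∂g.vol) := by
    rw [average_eq, integral_const, smul_eq_mul, smul_eq_mul, mul_one, inv_mul_eq_div]
  rw [toDistribution, havg, ← integral_const_mul (_ / _),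
    ← integral_sub hi1 (hf.integrable_of_compactSpace.const_mul _), ← integral_const_mul]
  refine integral_congr_ae (Filter.Eventually.of_forall fun x => ?_)
  ring

end HermitianMetric

end

theorem theorem1 (n : ℕ) (hn : 2 ≤ n) (M : Type*) [TopologicalSpace M] [CompactSpace M]
    [T2Space M] [MeasurableSpace M] [BorelSpace M] [ChartedSpace (CSpace n) M]
    [IsManifold 𝓘(ℂ, CSpace n) ω M] (g : HermitianMetric n M) (p : ℝ) (hp : 1 < p) :
    g.IsConformalExtremal p ↔
      g.boxAdjoint (fun x => g.chernScalar x * |g.chernScalar x| ^ (p - 2)) =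
        g.toDistribution (fun x => (n - p) / (n * p) *
          (|g.chernScalar x| ^ p - ⨍ y, |g.chernScalar y| ^ p ∂g.vol)) := by
  have hn0 : n ≠ 0 := by omega
  have hn' : (n : ℝ) ≠ 0 := Nat.cast_ne_zero.2 hn0
  have hp0 : p ≠ 0 := by linarith
  have := g.isFiniteMeasure_vol
  by_cases hV : ∫ _, (1 : ℝ) ∂g.vol = 0
  · -- With zero total volume, as for empty `M`, every integral vanishes and both sides hold.
    -- Treating this case apart spares a proof that a nonempty `M` has positive volume.
    have hvol : g.vol = 0 := by
      rw [integral_const, smul_eq_mul, mul_one, measureReal_eq_zero_iff] at hV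
      exact Measure.measure_univ_eq_zero.1 hV
    refine iff_of_true (fun f => ?_) (funext fun f => ?_)
    · simpa [HermitianMetric.calabi_conformal_smul, hvol] using hasDerivAt_const (0 : ℝ) (0 : ℝ)
    · simp [HermitianMetric.boxAdjoint, HermitianMetric.toDistribution, hvol]
  · have hV0 : 0 < ∫ _, (1 : ℝ) ∂g.vol :=
      lt_of_le_of_ne (integral_nonneg fun _ => zero_le_one) (Ne.symm hV)
    rw [funext_iff]
    refine forall_congr' fun f => ?_
    have hd := g.hasDerivAt_calabi_conformal hn0 hp hV f
    rw [g.toDistribution_sub_average hp, HermitianMetric.boxAdjoint]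
    have hiff : ∀ {D : ℝ}, HasDerivAt (fun t : ℝ => (g.conformal (t • f)).calabi p) D 0 →
        (HasDerivAt (fun t : ℝ => (g.conformal (t • f)).calabi p) 0 0 ↔ D = 0) :=
      fun hD => ⟨fun h => hD.unique h, fun h => h ▸ hD⟩
    rw [hiff hd, mul_eq_zero, or_iff_right (Real.rpow_pos_of_pos hV0 _).ne', sub_eq_zero]
    generalize ∫ x, g.chernScalar x * |g.chernScalar x| ^ (p - 2) * g.box f x ∂g.vol = b
    rw [div_mul_eq_mul_div (_ - p), eq_div_iff (mul_ne_zero hn' hp0), eq_comm, mul_comm b]
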